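/- **Setting.** Fix a first-order language with a countably infinite set of variables, a first-order theory $\mathcal{CT}$, and a set of formulas called *constraints* that contains $\bot$ and all equations between terms and is closed under renaming of variables. *Atoms* $p(t_1,\dots,t_n)$ are built with a separate set of predicate symbols. Commas denote multiset union, respectively conjunction; $\mathrm{fv}$ denotes free variables; $\exists_{-X}\phi$ is the existential closure of $\phi$ except for the variables in $X$. *Rules and programs.* A rule $(r\ @\ K\backslash H \Leftrightarrow G\mid B;C)$ consists of a name $r\in\mathcal R$, multisets of atoms $K,H,B$ with $(K,H)\neq\emptyset$, and conjunctions of constraints $G,C$. Its local variables are $\mathrm{lv}(r)=\mathrm{fv}(G,B,C)\setminus\mathrm{fv}(K,H)$. A CHR program is a finite set of rules with pairwise distinct names. *States.* A state $\langle E;D;\bar x\rangle$ consists of a finite multiset of atoms $E$, a conjunction of constraints $D$ and a finite set of variables $\bar x$. States are taken modulo the least equivalence relation $\equiv$ such that 1. $\langle E;D;\bar x\rangle\equiv\langle E;D';\bar x\rangle$ if $\mathcal{CT}\models \exists_{-(\mathrm{fv}(E)\cup\bar x)}D\leftrightarrow\exists_{-(\mathrm{fv}(E)\cup\bar x)}D'$;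 2. $\langle E;\bot;\bar x\rangle\equiv\langle F;\bot;\bar y\rangle$; 3. $\langle E,c;D,c{=}d;\bar x\rangle\equiv\langle E,d;D,c{=}d;\bar x\rangle$, where for atoms $c=p(\vec s)$, $d=p(\vec t)$ with the same predicate symbol $c{=}d$ is the conjunction of the $s_i=t_i$; 4. $\langle E;D;\bar x\rangle\equiv\langle E;D;\{y\}\cup\bar x\rangle$ if $y\notin\mathrm{fv}(E,D)$. The class of the states $\langle E;\bot;\bar x\rangle$ is the *failed* state; all other states are *consistent*. *Transitions.* For a set of rules $\mathcal P$, $$\langle K,H,E;\,G,D;\,\bar x\rangle\to_{\mathcal P}\langle K,B,E;\,G,C,D;\,\bar x\rangle$$ whenever $(r\ @\ K\backslash H\Leftrightarrow G\mid B;C)$ is a renaming (by a permutation of the variables) of a rule of $\mathcal P$ and $\mathrm{lv}(r)\cap(\mathrm{fv}(E,D)\cup\bar x)=\emptyset$. Write $\twoheadrightarrow$ for the reflexive-transitive closure and $\to^{=}$ for the reflexive closure of a relation $\to$. $\mathcal P$ is *confluent* if $S\twoheadrightarrow_{\mathcal P} S_1$ and $S\twoheadrightarrow_{\mathcal P} S_2$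 imply that some $S'$ satisfies $S_1\twoheadrightarrow_{\mathcal P} S'$ and $S_2\twoheadrightarrow_{\mathcal P} S'$. $\mathcal P$ is *terminating* if there is no infinite sequence $S_0\to_{\mathcal P}S_1\to_{\mathcal P}\cdots$ of consistent states. (The failed state has to be disregarded: every rule rewrites it to itself.) *Critical peaks.* Let $(r_1\ @\ K_1\backslash H_1\Leftrightarrow G_1\mid B_1;C_1)$ and $(r_2\ @\ K_2\backslash H_2\Leftrightarrow G_2\mid B_2;C_2)$ be renamings, without common variables, of a rule of $\mathcal P$ and a rule of $\mathcal Q$. Let $(K_1,H_1)=(H_1^\Delta,H_1^\cap)$ and $(K_2,H_2)=(H_2^\Delta,H_2^\cap)$ as multisets, with $H_1^\cap,H_2^\cap$ non-empty and their elements matched one-to-one, matched atoms having the same predicate symbol. Let $D=(H_1^\cap\doteq H_2^\cap,\,G_1,\,G_2)$, where $H_1^\cap\doteq H_2^\cap$ is the conjunction of the equations between matched atoms, and let $\bar x=\mathrm{fv}(K_1,H_1,K_2,H_2)$. Suppose that $\exists D$ holds in some model of $\mathcal{CT}$, and that $H_1^\cap\not\subseteq K_1$ or $H_2^\cap\not\subseteq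 K_2$ (multiset inclusion). Then $$\langle K_1,B_1,H_2^\Delta;D,C_1;\bar x\rangle\leftarrow_{r_1}\langle H_1^\Delta,H_1^\cap,H_2^\Delta;D;\bar x\rangle\to_{r_2}\langle K_2,B_2,H_1^\Delta;D,C_2;\bar x\rangle$$ is a *critical peak* between $\mathcal P$ and $\mathcal Q$. *Rule-decreasingness.* Let $\mathcal R=\mathcal R_i\uplus\mathcal R_c$ be a partition of the rule names into inductive and coinductive ones, and let $\mathcal P^i,\mathcal P^c\subseteq\mathcal P$ be the sets of rules of the program $\mathcal P$ with names in $\mathcal R_i$, $\mathcal R_c$. For $r\in\mathcal R$ let $\to_r$ be the transition relation of the rule of $\mathcal P$ named $r$ (empty if there is none), and for $M\subseteq\mathcal R$ let $\to_M=\bigcup_{r\in M}\to_r$. A preorder $\succcurlyeq$ on $\mathcal R$, with strict part $\succ$, is *admissible* if $r_c\succ r_i$ for all $r_i\in\mathcal R_i$, $r_c\in\mathcal R_c$. For $M\subseteq\mathcal R$ let ${\prec}M=\{\gamma\mid\exists\delta\in M,\ \delta\succ\gamma\}$ and ${\preccurlyeq}M=\{\gamma\mid\exists\delta\in M,\ \delta\succcurlyeq\gamma\}$.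 A peak $S_1\leftarrow_\alpha S\to_\beta S_2$ is *decreasing* if some $S'$ satisfies $$S_1\twoheadrightarrow_{\prec\{\alpha\}}\cdot\to^{=}_{\preccurlyeq\{\beta\}}\cdot\twoheadrightarrow_{\prec\{\alpha,\beta\}}S'\quad\text{and}\quad S_2\twoheadrightarrow_{\prec\{\beta\}}\cdot\to^{=}_{\preccurlyeq\{\alpha\}}\cdot\twoheadrightarrow_{\prec\{\alpha,\beta\}}S'.$$ The program $\mathcal P$ is *rule-decreasing* (for the given partition) if there is an admissible preorder $\succcurlyeq$ on $\mathcal R$ such that - $\mathcal P^i$ is terminating; - for every critical peak $S_1\leftarrow S\to S_2$ between $\mathcal P^i$ and $\mathcal P^i$ there is an $S'$ with $S_1\twoheadrightarrow_{\mathcal P^i}S'$ and $S_2\twoheadrightarrow_{\mathcal P^i}S'$; - every critical peak between $\mathcal P^c$ and $\mathcal P$ is decreasing with respect to $\succcurlyeq$. **Theorem.** For every partition $\mathcal R=\mathcal R_i\uplus\mathcal R_c$, every rule-decreasing CHR program is confluent. -/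

import Mathlib

universe u v w z

namespace CHR

section Definitions

/-- A language of built-in constraints: a set of first-order formulas with variables in `ℕ` that
contains falsity and all equations between terms and is closed under renaming of variables. -/
structure ConstraintLanguage (L : FirstOrder.Language.{u, v}) where
  carrier : Set (L.Formula ℕ)
  falsum_mem : (⊥ : L.Formula ℕ) ∈ carrier
  equal_mem : ∀ s t : L.Term ℕ, s.equal t ∈ carrier
  rename_mem : ∀ (ρ : Equiv.Perm ℕ) (φ : L.Formula ℕ), φ ∈ carrier → φ.relabel ρ ∈ carrier

variable {L : FirstOrder.Language.{u, v}}

abbrev Constraint (C : ConstraintLanguage L) := {φ : L.Formula ℕ // φ ∈ C.carrier}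

/-- A conjunction of constraints. The empty conjunction is truth. -/
abbrev Conj (C : ConstraintLanguage L) := Multiset (Constraint C)

section Constraints

variable {C : ConstraintLanguage L}

def Constraint.fv (c : Constraint C) : Finset ℕ :=
  FirstOrder.Language.BoundedFormula.freeVarFinset c.1

def Constraint.rename (ρ : Equiv.Perm ℕ) (c : Constraint C) : Constraint C :=
  ⟨c.1.relabel ρ, C.rename_mem ρ c.1 c.2⟩

def Constraint.falsum : Constraint C := ⟨⊥, C.falsum_mem⟩

def Constraint.equal (s t : L.Term ℕ) : Constraint C := ⟨s.equal t, C.equal_mem s t⟩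

def Conj.fv (D : Conj C) : Finset ℕ := (D.map Constraint.fv).sup

def Conj.rename (ρ : Equiv.Perm ℕ) (D : Conj C) : Conj C := D.map (Constraint.rename ρ)

def Conj.Holds (D : Conj C) {M : Type w} [L.Structure M] (val : ℕ → M) : Prop :=
  ∀ c ∈ D, c.1.Realize val

/-- The existential closure of `D` is satisfiable in some model of the theory. -/
def Conj.Satisfiable (CT : L.Theory) (D : Conj C) : Prop :=
  ∃ (M : FirstOrder.Language.Theory.ModelType.{u, v, max u v} CT) (val : ℕ → M), D.Holds val

/-- The existential closure of `D` with the exception of the variables in `X`. -/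
def Conj.ExHolds (X : Finset ℕ) (D : Conj C) {M : Type w} [L.Structure M] (val : ℕ → M) : Prop :=
  ∃ val' : ℕ → M, (∀ x ∈ X, val' x = val x) ∧ D.Holds val'

/-- In every model of the theory, `D` and `D'` are equivalent after existential quantification of
all variables outside `X`. -/
def Conj.EquivOver (CT : L.Theory) (X : Finset ℕ) (D D' : Conj C) : Prop :=
  ∀ (M : FirstOrder.Language.Theory.ModelType.{u, v, max u v} CT) (val : ℕ → M),
    D.ExHolds X val ↔ D'.ExHolds X val

end Constraints

/-- User-defined atoms, built from a separate family of predicate symbols `Pred n` of arity `n`. -/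
structure Atom (L : FirstOrder.Language.{u, v}) (Pred : ℕ → Type w) where
  arity : ℕ
  pred : Pred arity
  args : Fin arity → L.Term ℕ

variable {Pred : ℕ → Type w}

def Atom.fv (a : Atom L Pred) : Finset ℕ :=
  Finset.univ.biUnion fun i => (a.args i).varFinset

def Atom.rename (ρ : Equiv.Perm ℕ) (a : Atom L Pred) : Atom L Pred :=
  ⟨a.arity, a.pred, fun i => (a.args i).relabel ρ⟩

def atomsFv (A : Multiset (Atom L Pred)) : Finset ℕ := (A.map Atom.fv).sup

def atomsRename (ρ : Equiv.Perm ℕ) (A : Multiset (Atom L Pred)) : Multiset (Atom L Pred) :=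
  A.map (Atom.rename ρ)

/-- An equation `p(s₁, …, sₙ) ≐ p(t₁, …, tₙ)` between two atoms with the same predicate symbol. -/
structure AtomEq (L : FirstOrder.Language.{u, v}) (Pred : ℕ → Type w) where
  arity : ℕ
  pred : Pred arity
  left : Fin arity → L.Term ℕ
  right : Fin arity → L.Term ℕ

def AtomEq.lhs (e : AtomEq L Pred) : Atom L Pred := ⟨e.arity, e.pred, e.left⟩

def AtomEq.rhs (e : AtomEq L Pred) : Atom L Pred := ⟨e.arity, e.pred, e.right⟩

/-- The equation as a constraint: the conjunction of the `sᵢ = tᵢ`. -/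
def AtomEq.conj (C : ConstraintLanguage L) (e : AtomEq L Pred) : Conj C :=
  (Finset.univ : Finset (Fin e.arity)).val.map fun i => Constraint.equal (e.left i) (e.right i)

/-- The conjunction of a multiset of equations between atoms. -/
def matchConj (C : ConstraintLanguage L) (m : Multiset (AtomEq L Pred)) : Conj C :=
  (m.map (AtomEq.conj C)).sum

variable {C : ConstraintLanguage L}

/-- A concrete state: user store, built-in store and global variables. -/
structure PreState (C : ConstraintLanguage L) (Pred : ℕ → Type w) where
  user : Multiset (Atom L Pred)
  builtin : Conj C
  globals : Finset ℕ

/-- The generating rules of state equivalence. -/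
inductive StateRel (CT : L.Theory) : PreState C Pred → PreState C Pred → Prop
  | builtin (A : Multiset (Atom L Pred)) (D D' : Conj C) (X : Finset ℕ) :
      Conj.EquivOver CT (atomsFv A ∪ X) D D' → StateRel CT ⟨A, D, X⟩ ⟨A, D', X⟩
  | failed (A A' : Multiset (Atom L Pred)) (X X' : Finset ℕ) :
      StateRel CT ⟨A, {Constraint.falsum}, X⟩ ⟨A', {Constraint.falsum}, X'⟩
  | equality (A : Multiset (Atom L Pred)) (D : Conj C) (e : AtomEq L Pred) (X : Finset ℕ) :
      StateRel CT ⟨A + {e.lhs}, D + e.conj C, X⟩ ⟨A + {e.rhs}, D + e.conj C, X⟩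
  | omission (A : Multiset (Atom L Pred)) (D : Conj C) (X : Finset ℕ) (y : ℕ) :
      y ∉ atomsFv A ∪ D.fv → StateRel CT ⟨A, D, X⟩ ⟨A, D, insert y X⟩

/-- State equivalence: the least equivalence relation containing the generating rules. -/
def stateSetoid (CT : L.Theory) (C : ConstraintLanguage L) (Pred : ℕ → Type w) :
    Setoid (PreState C Pred) :=
  Relation.EqvGen.setoid (StateRel CT)

/-- States, taken modulo state equivalence. -/
def State (CT : L.Theory) (C : ConstraintLanguage L) (Pred : ℕ → Type w) :=
  Quotient (stateSetoid CT C Pred)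

def mkState (CT : L.Theory) (A : Multiset (Atom L Pred)) (D : Conj C) (X : Finset ℕ) :
    State CT C Pred :=
  Quotient.mk (stateSetoid CT C Pred) ⟨A, D, X⟩

/-- The failed state: the common equivalence class of all states with inconsistent built-in
store. -/
def failedState (CT : L.Theory) (C : ConstraintLanguage L) (Pred : ℕ → Type w) :
    State CT C Pred :=
  mkState CT 0 {Constraint.falsum} ∅

/-- A rule `name @ kept \ removed ⟺ guard | userBody; builtinBody`. -/
structure Rule (C : ConstraintLanguage L) (Pred : ℕ → Type w) (R : Type z) where
  name : R
  kept : Multiset (Atom L Pred)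
  removed : Multiset (Atom L Pred)
  guard : Conj C
  userBody : Multiset (Atom L Pred)
  builtinBody : Conj C
  heads_ne : kept + removed ≠ 0

variable {R : Type z}

namespace Rule

def rename (ρ : Equiv.Perm ℕ) (r : Rule C Pred R) : Rule C Pred R where
  name := r.name
  kept := atomsRename ρ r.kept
  removed := atomsRename ρ r.removed
  guard := r.guard.rename ρ
  userBody := atomsRename ρ r.userBody
  builtinBody := r.builtinBody.rename ρ
  heads_ne := by
    have h := r.heads_ne
    simpa [atomsRename, ← Multiset.map_add] using h

def headFv (r : Rule C Pred R) : Finset ℕ := atomsFv (r.kept + r.removed)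

def fv (r : Rule C Pred R) : Finset ℕ :=
  r.headFv ∪ r.guard.fv ∪ atomsFv r.userBody ∪ r.builtinBody.fv

/-- The local variables of a rule: those that do not occur in its heads. -/
def lv (r : Rule C Pred R) : Finset ℕ := r.fv \ r.headFv

end Rule

/-- The transition relation of a set of rules, on states modulo equivalence. -/
def Step (CT : L.Theory) (P : Set (Rule C Pred R)) (S T : State CT C Pred) : Prop :=
  ∃ r₀ ∈ P, ∃ (ρ : Equiv.Perm ℕ) (r : Rule C Pred R) (E : Multiset (Atom L Pred)) (D : Conj C)
    (X : Finset ℕ),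
    r = r₀.rename ρ ∧
    Disjoint r.lv (atomsFv E ∪ D.fv ∪ X) ∧
    S = mkState CT (r.kept + r.removed + E) (r.guard + D) X ∧
    T = mkState CT (r.kept + r.userBody + E) (r.guard + r.builtinBody + D) X

/-- A program: a finite set of rules with pairwise distinct names. -/
structure Program (C : ConstraintLanguage L) (Pred : ℕ → Type w) (R : Type z) where
  rules : Set (Rule C Pred R)
  finite : rules.Finite
  name_inj : Set.InjOn Rule.name rules

/-- Confluence of a binary relation. -/
def Confluent {α : Type z} (r : α → α → Prop) : Prop :=
  ∀ a b c, Relation.ReflTransGen r a b → Relation.ReflTransGen r a c →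
    Relation.Join (Relation.ReflTransGen r) b c

/-- Termination: there is no infinite sequence of transitions between consistent states. The failed
state, on which every rule applies and which every rule rewrites to itself, is disregarded. -/
def Terminating (CT : L.Theory) (P : Set (Rule C Pred R)) : Prop :=
  ¬ ∃ f : ℕ → State CT C Pred,
    ∀ n, f n ≠ failedState CT C Pred ∧ Step CT P (f n) (f (n + 1))

namespace Program

def Confluent (CT : L.Theory) (P : Program C Pred R) : Prop :=
  CHR.Confluent (Step CT P.rules)

/-- The rules with inductive name, where `Ri` is the set of inductive rule identifiers. -/
def inductivePart (P : Program C Pred R) (Ri : Set R) : Set (Rule C Pred R) :=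
  {r ∈ P.rules | r.name ∈ Ri}

/-- The rules with coinductive name, that is, with a name outside `Ri`. -/
def coinductivePart (P : Program C Pred R) (Ri : Set R) : Set (Rule C Pred R) :=
  {r ∈ P.rules | r.name ∉ Ri}

/-- The rule-labeling: the transitions made with the rule named `a`. -/
def labelStep (CT : L.Theory) (P : Program C Pred R) (a : R) :
    State CT C Pred → State CT C Pred → Prop :=
  Step CT {r ∈ P.rules | r.name = a}

end Program

/-- `IsCriticalPeak CT P Q a b Sl Sc Sr`: the peak `Sl ← Sc → Sr` is a critical peak between a rule
of `P` named `a` and a rule of `Q` named `b`. The overlap is given by a multiset `m` of equations,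
which pairs the overlapping head atoms of the first rule with those of the second rule. -/
def IsCriticalPeak (CT : L.Theory) (P Q : Set (Rule C Pred R)) (a b : R)
    (Sl Sc Sr : State CT C Pred) : Prop :=
  ∃ r₁ ∈ P, ∃ r₂ ∈ Q, ∃ (ρ₁ ρ₂ : Equiv.Perm ℕ) (q₁ q₂ : Rule C Pred R)
    (Δ₁ Δ₂ : Multiset (Atom L Pred)) (m : Multiset (AtomEq L Pred)) (D : Conj C) (X : Finset ℕ),
    r₁.name = a ∧ r₂.name = b ∧
    q₁ = r₁.rename ρ₁ ∧ q₂ = r₂.rename ρ₂ ∧ Disjoint q₁.fv q₂.fv ∧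
    m ≠ 0 ∧
    q₁.kept + q₁.removed = Δ₁ + m.map AtomEq.lhs ∧
    q₂.kept + q₂.removed = Δ₂ + m.map AtomEq.rhs ∧
    X = q₁.headFv ∪ q₂.headFv ∧
    D = matchConj C m + q₁.guard + q₂.guard ∧
    D.Satisfiable CT ∧
    (¬ m.map AtomEq.lhs ≤ q₁.kept ∨ ¬ m.map AtomEq.rhs ≤ q₂.kept) ∧
    Sc = mkState CT (Δ₁ + m.map AtomEq.lhs + Δ₂) D X ∧
    Sl = mkState CT (q₁.kept + q₁.userBody + Δ₂) (D + q₁.builtinBody) X ∧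
    Sr = mkState CT (q₂.kept + q₂.userBody + Δ₁) (D + q₂.builtinBody) X

/-- The union of the members of a family of relations whose label lies in `K`. -/
def unionOver {ι : Type z} {α : Type w} (step : ι → α → α → Prop) (K : Set ι) (x y : α) : Prop :=
  ∃ i ∈ K, step i x y

def strictlyBelow {ι : Type z} [Preorder ι] (K : Set ι) : Set ι := {i | ∃ k ∈ K, i < k}

def weaklyBelow {ι : Type z} [Preorder ι] (K : Set ι) : Set ι := {i | ∃ k ∈ K, i ≤ k}

/-- One side of a decreasing diagram for a local peak: the side that starts at the end of the step
labeled `a`, the other step being labeled `b`. -/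
def DecreasingSide {ι : Type z} {α : Type w} [Preorder ι] (step : ι → α → α → Prop) (a b : ι)
    (x y : α) : Prop :=
  ∃ x₁ x₂, Relation.ReflTransGen (unionOver step (strictlyBelow {a})) x x₁ ∧
    Relation.ReflGen (unionOver step (weaklyBelow {b})) x₁ x₂ ∧
    Relation.ReflTransGen (unionOver step (strictlyBelow {a, b})) x₂ y

/-- A local peak `x ← · → y` with labels `a` (left) and `b` (right) is decreasing. -/
def DecreasingPeak {ι : Type z} {α : Type w} [Preorder ι] (step : ι → α → α → Prop) (a b : ι)
    (x y : α) : Prop :=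
  ∃ e, DecreasingSide step a b x e ∧ DecreasingSide step b a y e

/-- A preorder on rule identifiers is admissible if inductive identifiers are strictly smaller than
coinductive ones. -/
def Admissible (Ri : Set R) (pre : Preorder R) : Prop :=
  ∀ i ∈ Ri, ∀ c ∉ Ri, pre.lt i c

/-- Rule-decreasingness with respect to a preorder, `Ri` being the set of inductive rule
identifiers. -/
structure RuleDecreasingWrt (CT : L.Theory) (P : Program C Pred R) (Ri : Set R)
    (pre : Preorder R) : Prop where
  terminating : Terminating CT (P.inductivePart Ri)
  inductive_joinable : ∀ a b Sl Sc Sr,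
    IsCriticalPeak CT (P.inductivePart Ri) (P.inductivePart Ri) a b Sl Sc Sr →
      Relation.Join (Relation.ReflTransGen (Step CT (P.inductivePart Ri))) Sl Sr
  coinductive_decreasing : ∀ a b Sl Sc Sr,
    IsCriticalPeak CT (P.coinductivePart Ri) P.rules a b Sl Sc Sr →
      DecreasingPeak (P.labelStep CT) a b Sl Sr

/-- Rule-decreasingness: with respect to some admissible preorder. -/
def RuleDecreasing (CT : L.Theory) (P : Program C Pred R) (Ri : Set R) : Prop :=
  ∃ pre : Preorder R, Admissible Ri pre ∧ RuleDecreasingWrt CT P Ri pre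

end Definitions

end CHR

/-! Confluence comes from van Oostrom's decreasing diagrams, applied to a labeling that refines the
names of the rules.

Abstract part. A word of labels is measured by the multiset of those letters that no larger letter
precedes (`measure`). Multisets are compared at the largest label where they differ. A path `t'`
that continues `s` and closes a diagram against `t` is good if the measure of `s ++ t'` is at most
that of `s` plus that of `t`; after cancelling the measure of `s` this is `Closes`. Good diagrams
can be pasted (`Closes.paste_top`, `Closes.paste_side`), and removing a good local diagram from a
peak lowers the sum of the measures. Well-founded induction on this sum completes every peak
(`LocallyDecreasing.diagram`).

Critical peaks. State equivalence is syntactic, but it has a semantic description: given a model and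
values for the global variables, a state denotes the set of instances of its atoms that its built-in
store allows. Equivalent states have the same denotation up to the order of atoms
(`semLE_of_eqvGen`), and equal denotations imply equivalence (`mkState_eq_of_sameDenotation`). Hence
two presentations of a consistent state yield a matching of their atoms by equations, and adding a
context to a state is well defined on classes and compatible with transitions
(`exists_extend_step`). If both rules keep all the head atoms matched with each other, the two steps
commute; otherwise the peak is a critical peak in a context (`peak_cases`).

Labels. Critical peaks between inductive rules are merely joinable, so names alone do not suffice.
An inductive transition is labeled by the ordinal rank of its source under the terminating inductive
relation, as in Newman's lemma. A coinductive transition is labeled by the rank of its name among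
the finitely many names of the program. All inductive labels lie below all coinductive ones. The
failed state has only loops, so transitions from it can be dropped without changing reachability
(`reflTransGen_rankStep`). -/

set_option linter.unusedSectionVars false

namespace CHR

/-! ### Decreasing diagrams for a well-founded linear order of labels -/

section DecreasingDiagrams

variable {Λ : Type*} [LinearOrder Λ]

/-- The multiset of the labels of `x` that are at least `c`. -/
noncomputable def cutoff (c : WithBot Λ) (x : Colex (Λ →₀ ℕ)) : Colex (Λ →₀ ℕ) :=
  toColex ((ofColex x).filter fun l => c ≤ (l : WithBot Λ))

noncomputable def unit (a : Λ) : Colex (Λ →₀ ℕ) := toColex (Finsupp.single a 1)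

/-- The lexicographic maximum measure of a word of labels. -/
noncomputable def measure : List Λ → Colex (Λ →₀ ℕ)
  | [] => 0
  | a :: l => unit a + cutoff a (measure l)

def top : List Λ → WithBot Λ
  | [] => ⊥
  | a :: l => max (a : WithBot Λ) (top l)

theorem cutoff_apply (c : WithBot Λ) (x : Colex (Λ →₀ ℕ)) (l : Λ) :
    ofColex (cutoff c x) l = if c ≤ (l : WithBot Λ) then ofColex x l else 0 := by
  simp [cutoff, Finsupp.filter_apply]

theorem unit_apply (a l : Λ) : ofColex (unit a) l = if a = l then 1 else 0 := by
  simp [unit, Finsupp.single_apply]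

theorem colex_ext {x y : Colex (Λ →₀ ℕ)} (h : ∀ l, ofColex x l = ofColex y l) : x = y :=
  ofColex.injective (Finsupp.ext h)

theorem ofColex_add_apply (x y : Colex (Λ →₀ ℕ)) (l : Λ) :
    ofColex (x + y) l = ofColex x l + ofColex y l := rfl

theorem ofColex_zero_apply (l : Λ) : ofColex (0 : Colex (Λ →₀ ℕ)) l = 0 := rfl

theorem cutoff_add (c : WithBot Λ) (x y : Colex (Λ →₀ ℕ)) :
    cutoff c (x + y) = cutoff c x + cutoff c y := by
  apply colex_ext; intro l
  simp only [ofColex_add_apply, cutoff_apply]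
  split_ifs <;> simp

theorem cutoff_zero (c : WithBot Λ) : cutoff c (0 : Colex (Λ →₀ ℕ)) = 0 := by
  apply colex_ext; intro l
  simp [cutoff_apply]

theorem cutoff_bot (x : Colex (Λ →₀ ℕ)) : cutoff ⊥ x = x := by
  apply colex_ext; intro l
  simp [cutoff_apply]

theorem cutoff_cutoff (c d : WithBot Λ) (x : Colex (Λ →₀ ℕ)) :
    cutoff c (cutoff d x) = cutoff (max c d) x := by
  apply colex_ext; intro l
  simp only [cutoff_apply, max_le_iff]
  split_ifs <;> simp_all

theorem cutoff_mono (c : WithBot Λ) {x y : Colex (Λ →₀ ℕ)} (h : x ≤ y) :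
    cutoff c x ≤ cutoff c y := by
  rcases h.eq_or_lt with rfl | h
  · exact le_rfl
  obtain ⟨i, hi, hlt⟩ := Finsupp.Colex.lt_iff.1 h
  by_cases hc : c ≤ (i : WithBot Λ)
  · refine (Finsupp.Colex.lt_iff.2 ⟨i, fun j hj => ?_, ?_⟩).le
    · rw [cutoff_apply, cutoff_apply, hi j hj]
    · rw [cutoff_apply, cutoff_apply, if_pos hc, if_pos hc]; exact hlt
  · refine le_of_eq (colex_ext fun l => ?_)
    rw [cutoff_apply, cutoff_apply]
    split_ifs with h'
    · apply hi
      exact WithBot.coe_lt_coe.1 ((not_le.1 hc).trans_le h')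
    · rfl

theorem le_of_apply_le {x y : Colex (Λ →₀ ℕ)} (h : ∀ l, ofColex x l ≤ ofColex y l) : x ≤ y :=
  Finsupp.toColex_monotone (a := ofColex x) (b := ofColex y) h

theorem cutoff_anti {c d : WithBot Λ} (h : c ≤ d) (x : Colex (Λ →₀ ℕ)) :
    cutoff d x ≤ cutoff c x := by
  apply le_of_apply_le; intro l
  simp only [cutoff_apply]
  split_ifs with h1 h2
  · exact le_rfl
  · exact absurd (h.trans h1) h2
  · exact Nat.zero_le _
  · exact le_rfl

theorem cutoff_le (c : WithBot Λ) (x : Colex (Λ →₀ ℕ)) : cutoff c x ≤ x := by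
  simpa [cutoff_bot] using cutoff_anti (bot_le (a := c)) x

/-- One additional `a` outweighs all labels below `a` together. Every strict decrease of the measure
comes from this. -/
theorem lt_cutoff_add_unit (a : Λ) (x : Colex (Λ →₀ ℕ)) : x < cutoff a x + unit a := by
  refine Finsupp.Colex.lt_iff.2 ⟨a, fun j hj => ?_, ?_⟩
  · rw [ofColex_add_apply, cutoff_apply, unit_apply, if_pos (WithBot.coe_le_coe.2 hj.le),
      if_neg hj.ne, add_zero]
  · rw [ofColex_add_apply, cutoff_apply, unit_apply]
    simp

theorem lt_unit_of_cutoff_eq_zero {b : Λ} {x : Colex (Λ →₀ ℕ)} (h : cutoff b x = 0) :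
    x < unit b := by
  simpa [h] using lt_cutoff_add_unit b x

theorem cutoff_unit_of_le {c : WithBot Λ} {a : Λ} (h : c ≤ a) : cutoff c (unit a) = unit a := by
  apply colex_ext; intro l
  simp only [cutoff_apply, unit_apply]
  split_ifs <;> simp_all

theorem cutoff_unit_of_lt {c : WithBot Λ} {a : Λ} (h : (a : WithBot Λ) < c) :
    cutoff c (unit a) = 0 := by
  apply colex_ext; intro l
  simp only [cutoff_apply, unit_apply, ofColex_zero_apply]
  split_ifs with h1 h2
  · subst h2; exact absurd h1 (not_le.2 h)
  · rfl
  · rfl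

theorem top_append (s t : List Λ) : top (s ++ t) = max (top s) (top t) := by
  induction s with
  | nil => simp [top]
  | cons a s ih => simp [top, ih, max_assoc]

theorem measure_append (s t : List Λ) :
    measure (s ++ t) = measure s + cutoff (top s) (measure t) := by
  induction s with
  | nil => simp [measure, top, cutoff_bot]
  | cons a s ih => simp [measure, top, ih, cutoff_add, cutoff_cutoff, add_assoc]

theorem cutoff_measure_eq_zero {c : WithBot Λ} {s : List Λ} (h : top s < c) :
    cutoff c (measure s) = 0 := by
  induction s with
  | nil => exact cutoff_zero c
  | cons a s ih =>
    have h' : (a : WithBot Λ) < c ∧ top s < c := max_lt_iff.1 h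
    rw [measure, cutoff_add, cutoff_unit_of_lt h'.1, cutoff_cutoff, max_eq_left h'.1.le, ih h'.2,
      add_zero]

/-- A greatest letter of the word is never discarded, because no larger letter precedes it. -/
theorem unit_le_measure {a : Λ} {s : List Λ} (h : top s = a) : unit a ≤ measure s := by
  induction s with
  | nil => simp [top] at h
  | cons b s ih =>
    rw [measure]
    rcases max_choice (b : WithBot Λ) (top s) with h' | h'
    · rw [top, h'] at h
      rw [WithBot.coe_inj.1 h]
      exact le_add_of_nonneg_right zero_le
    · rw [top, h'] at h
      have hb : (b : WithBot Λ) ≤ a := by rw [← h, ← h']; exact le_max_left _ _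
      calc unit a = cutoff b (unit a) := (cutoff_unit_of_le hb).symm
        _ ≤ cutoff b (measure s) := cutoff_mono _ (ih h)
        _ ≤ _ := le_add_of_nonneg_left zero_le

/-- If the greatest letter were at least `a`, it would be in the measure and would survive the cut.
-/
theorem top_lt_of_cutoff_measure_eq_zero {a : Λ} {s : List Λ} (h : cutoff a (measure s) = 0) :
    top s < a := by
  by_contra hn
  obtain ⟨b, hb⟩ := WithBot.ne_bot_iff_exists.1 (ne_bot_of_le_ne_bot WithBot.coe_ne_bot (not_lt.1 hn))
  have h1 := cutoff_mono (a : WithBot Λ) (unit_le_measure hb.symm)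
  rw [h, cutoff_unit_of_le (by rw [hb]; exact not_lt.1 hn)] at h1
  have h2 := lt_cutoff_add_unit b (0 : Colex (Λ →₀ ℕ))
  rw [cutoff_zero, zero_add] at h2
  exact absurd h1 (not_le.2 h2)

/-- `t'` closes a diagram opened by `s` and `t` on the side of `s`, without exceeding `t`. -/
def Closes (s t t' : List Λ) : Prop := cutoff (top s) (measure t') ≤ measure t

/-- Cutting at the top of `s₁ ++ s₂` is cutting first at the top of `s₂` and then at that of `s₁`,
so the two bounds compose by monotonicity. -/
theorem Closes.paste_top {s₁ s₂ t t' t'' : List Λ} (h₁ : Closes s₁ t t') (h₂ : Closes s₂ t' t'') :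
    Closes (s₁ ++ s₂) t t'' := by
  unfold Closes at *
  rw [top_append, ← cutoff_cutoff]
  exact (cutoff_mono _ h₂).trans h₁

/-- The letters of `s₂'` are cut by `t` and `s₁'`, while those of `s₂` are cut by `s₁`. If `s₁` cuts
no more than `t` and `s₁'` do, the bounds add up term by term. Otherwise the top letter of `s₁`
exceeds all letters of `t` and `s₁'`, and its occurrence in the measure of `s₁` outweighs every
smaller label on the left. -/
theorem Closes.paste_side {s₁ s₂ s₁' s₂' t t' : List Λ} (h₁ : Closes s₁ t t')
    (h₁' : Closes t s₁ s₁') (h₂' : Closes t' s₂ s₂') :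
    Closes t (s₁ ++ s₂) (s₁' ++ s₂') := by
  unfold Closes at *
  rw [measure_append, measure_append, cutoff_add, cutoff_cutoff]
  rcases le_or_gt (top s₁) (max (top t) (top s₁')) with hc | hc
  · have ht' : top t' ≤ max (top t) (top s₁') := by
      by_contra hn
      rw [not_le] at hn
      obtain ⟨b, hb⟩ := WithBot.ne_bot_iff_exists.1 (ne_bot_of_gt hn)
      rw [← hb] at hn
      have h3 := cutoff_mono (b : WithBot Λ) h₁
      rw [cutoff_measure_eq_zero ((le_max_left _ _).trans_lt hn), cutoff_cutoff,
        max_eq_left (hc.trans hn.le)] at h3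
      have := top_lt_of_cutoff_measure_eq_zero (le_antisymm h3 zero_le)
      rw [hb] at this
      exact lt_irrefl _ this
    refine add_le_add h₁' ?_
    calc _ = cutoff (max (top t) (top s₁')) (cutoff (top t') (measure s₂')) := by
          rw [cutoff_cutoff, max_eq_left ht']
      _ ≤ cutoff (max (top t) (top s₁')) (measure s₂) := cutoff_mono _ h₂'
      _ ≤ _ := cutoff_anti hc _
  · obtain ⟨a, ha⟩ := WithBot.ne_bot_iff_exists.1 (ne_bot_of_gt hc)
    rw [← ha] at hc h₁ ⊢
    have hc' := max_lt_iff.1 hc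
    have ht' : top t' < a := by
      apply top_lt_of_cutoff_measure_eq_zero
      have h3 := cutoff_mono (a : WithBot Λ) h₁
      rw [cutoff_cutoff, max_self, cutoff_measure_eq_zero hc'.1] at h3
      exact le_antisymm h3 zero_le
    -- Labels below `a` are traded for one `a`, which the measure of `s₁` supplies.
    refine (lt_cutoff_add_unit a _).le.trans ?_
    rw [add_comm (measure s₁)]
    refine add_le_add ?_ (unit_le_measure ha.symm)
    rw [cutoff_add, cutoff_cutoff, cutoff_cutoff, max_eq_left hc'.1.le, max_eq_left hc.le,
      cutoff_measure_eq_zero hc'.2, zero_add]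
    calc _ = cutoff a (cutoff (top t') (measure s₂')) := by rw [cutoff_cutoff, max_eq_left ht'.le]
      _ ≤ _ := cutoff_mono _ h₂'

/-! ### Paths and the completion of peaks -/

variable {α : Type*}

/-- `Path step s x y`: the word `s` labels a sequence of steps from `x` to `y`. -/
inductive Path (step : Λ → α → α → Prop) : List Λ → α → α → Prop
  | nil (x : α) : Path step [] x x
  | cons {a s x y z} : step a x y → Path step s y z → Path step (a :: s) x z

theorem Path.append {step : Λ → α → α → Prop} {s t : List Λ} {x y z : α}
    (h : Path step s x y) (h' : Path step t y z) : Path step (s ++ t) x z := by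
  induction h with
  | nil => exact h'
  | cons h1 _ ih => exact .cons h1 (ih h')

def LocallyDecreasing (step : Λ → α → α → Prop) : Prop :=
  ∀ a b x y z, step a x y → step b x z → ∃ e s t, Path step t y e ∧ Path step s z e ∧
    Closes [a] [b] t ∧ Closes [b] [a] s

theorem measure_lt_of_closes {a : Λ} {s t t' : List Λ} (h : Closes [a] t t') :
    measure s + measure t' < measure (a :: s) + measure t := by
  have h' : cutoff a (measure t') ≤ measure t := by simpa [Closes, top] using h
  refine (lt_cutoff_add_unit a _).trans_le ?_
  rw [cutoff_add, measure, add_comm (unit a), add_right_comm]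
  gcongr

/-- Any peak in a locally decreasing family of relations can be completed to a diagram. -/
theorem LocallyDecreasing.diagram [WellFoundedLT Λ] {step : Λ → α → α → Prop}
    (hstep : LocallyDecreasing step) (m : Colex (Λ →₀ ℕ)) :
    ∀ (s t : List Λ) (x y z : α), measure s + measure t = m → Path step s x y → Path step t x z →
      ∃ e s' t', Path step t' y e ∧ Path step s' z e ∧ Closes s t t' ∧ Closes t s s' := by
  induction m using WellFoundedLT.induction with
  | ind m ih =>
  intro s t x y z hm hs ht
  cases hs with
  | nil => exact ⟨z, [], t, ht, .nil z, cutoff_le _ _, by simp [Closes, measure, cutoff_zero]⟩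
  | @cons a s _ x₁ _ ha hs =>
  cases ht with
  | nil =>
    exact ⟨y, a :: s, [], .nil y, .cons ha hs, by simp [Closes, measure, cutoff_zero],
      cutoff_le _ _⟩
  | @cons b t _ x₂ _ hb ht =>
  -- The first two steps are closed by a local diagram, the rest `s` is then completed against `t₁`,
  -- and the composed side `s₁ ++ s₂` against the rest `t`.
  obtain ⟨e₁, s₁, t₁, ht₁, hs₁, ct₁, cs₁⟩ := hstep a b x x₁ x₂ ha hb
  have hlt : measure s + measure t₁ < m := by
    rw [← hm]
    refine (measure_lt_of_closes ct₁).trans_le ?_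
    refine add_le_add le_rfl ?_
    rw [measure, measure, measure, cutoff_zero, add_zero]
    exact le_add_of_nonneg_right zero_le
  obtain ⟨e₂, s₂, t₂, ht₂, hs₂, ct₂, cs₂⟩ := ih _ hlt s t₁ x₁ y e₁ rfl hs ht₁
  have ct : Closes (a :: s) [b] t₂ := ct₁.paste_top ct₂
  have cs : Closes [b] (a :: s) (s₁ ++ s₂) := ct₁.paste_side cs₁ cs₂
  have hlt' : measure (s₁ ++ s₂) + measure t < m := by
    rw [← hm, add_comm, add_comm (measure (a :: s))]
    exact measure_lt_of_closes cs
  obtain ⟨e₃, s₃, t₃, ht₃, hs₃, ct₃, cs₃⟩ :=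
    ih _ hlt' (s₁ ++ s₂) t x₂ e₂ z rfl (hs₁.append hs₂) ht
  exact ⟨e₃, s₃, t₂ ++ t₃, ht₂.append ht₃, hs₃, cs.paste_side ct ct₃, cs.paste_top cs₃⟩

theorem exists_path {step : Λ → α → α → Prop} {Q : Λ → Prop} {x y : α}
    (h : Relation.ReflTransGen (fun x y => ∃ a, Q a ∧ step a x y) x y) :
    ∃ s, (∀ a ∈ s, Q a) ∧ Path step s x y := by
  induction h using Relation.ReflTransGen.head_induction_on with
  | refl => exact ⟨[], by simp, .nil y⟩
  | head h _ ih =>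
    obtain ⟨a, ha, h⟩ := h
    obtain ⟨s, hs, p⟩ := ih
    exact ⟨a :: s, by simpa [ha] using hs, .cons h p⟩

theorem Path.reflTransGen {step : Λ → α → α → Prop} {s : List Λ} {x y : α}
    (h : Path step s x y) : Relation.ReflTransGen (fun x y => ∃ a, step a x y) x y := by
  induction h with
  | nil => exact .refl
  | cons h _ ih => exact .head ⟨_, h⟩ ih

theorem LocallyDecreasing.confluent [WellFoundedLT Λ] {α : Type z} {step : Λ → α → α → Prop}
    (hstep : LocallyDecreasing step) : Confluent fun x y => ∃ a, step a x y := by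
  intro x y z hy hz
  obtain ⟨s, -, hs⟩ := exists_path (Q := fun _ => True) (step := step) (by simpa using hy)
  obtain ⟨t, -, ht⟩ := exists_path (Q := fun _ => True) (step := step) (by simpa using hz)
  obtain ⟨e, s', t', ht', hs', -, -⟩ := hstep.diagram _ s t x y z rfl hs ht
  exact ⟨e, ht'.reflTransGen, hs'.reflTransGen⟩

theorem top_lt_coe {s : List Λ} {b : Λ} (h : ∀ a ∈ s, a < b) : top s < b := by
  induction s with
  | nil => exact WithBot.bot_lt_coe b
  | cons a s ih =>
    simp only [List.mem_cons, forall_eq_or_imp] at h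
    exact max_lt (WithBot.coe_lt_coe.2 h.1) (ih h.2)

theorem cutoff_measure_eq_zero_of_or {a b c : WithBot Λ} {s : List Λ}
    (h : ∀ l ∈ s, (l : WithBot Λ) < a ∨ (l : WithBot Λ) < b) (ha : a ≤ c) (hb : b ≤ c) :
    cutoff c (measure s) = 0 := by
  induction s with
  | nil => exact cutoff_zero c
  | cons l s ih =>
    simp only [List.mem_cons, forall_eq_or_imp] at h
    have hl : (l : WithBot Λ) < c := h.1.elim (·.trans_le ha) (·.trans_le hb)
    rw [measure, cutoff_add, cutoff_unit_of_lt hl, cutoff_cutoff, max_eq_left hl.le, ih h.2,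
      add_zero]

/-- The shape of van Oostrom's decreasing diagrams ensures that they close. -/
theorem closes_of_shape {a b : Λ} {s₁ s₂ s₃ : List Λ} (h₁ : ∀ l ∈ s₁, l < a)
    (h₂ : ∀ l ∈ s₂, l ≤ b) (h₂' : s₂.length ≤ 1) (h₃ : ∀ l ∈ s₃, l < a ∨ l < b) :
    Closes [a] [b] (s₁ ++ (s₂ ++ s₃)) := by
  have ha : top [a] = a := by simp [top]
  have hb : measure [b] = unit b := by simp [measure, cutoff_zero]
  have h₃' : ∀ c : Λ, a ≤ c → b ≤ c → cutoff c (measure s₃) = 0 := fun c hac hbc =>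
    cutoff_measure_eq_zero_of_or (a := a) (b := b)
      (fun l hl => (h₃ l hl).imp WithBot.coe_lt_coe.2 WithBot.coe_lt_coe.2)
      (WithBot.coe_le_coe.2 hac) (WithBot.coe_le_coe.2 hbc)
  have hmax : ∀ b : Λ, max (a : WithBot Λ) b = (max a b : Λ) := fun b => rfl
  unfold Closes
  rw [ha, hb, measure_append, cutoff_add, cutoff_measure_eq_zero (top_lt_coe h₁), zero_add,
    cutoff_cutoff]
  -- The cut at the letters of `s₁` is no longer needed. What is left must be bounded by a single
  -- `b`: either all its labels are below `b`, or it is at most the letter `e = b` itself, since the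
  -- cut at `max a b` removes `s₃`.
  refine (cutoff_anti (le_max_left _ _) _).trans ?_
  match s₂, h₂, h₂' with
  | [], _, _ =>
    refine (lt_unit_of_cutoff_eq_zero ?_).le
    rw [List.nil_append, cutoff_cutoff, max_comm, hmax]
    exact h₃' _ (le_max_left _ _) (le_max_right _ _)
  | [e], h₂, _ =>
    have he : e ≤ b := h₂ e (by simp)
    rw [List.singleton_append, measure, cutoff_add, cutoff_cutoff]
    rcases he.eq_or_lt with rfl | he
    · rw [hmax, h₃' _ (le_max_left _ _) (le_max_right _ _), add_zero]
      exact cutoff_le _ _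
    · refine (lt_unit_of_cutoff_eq_zero ?_).le
      rw [cutoff_add, cutoff_cutoff, cutoff_cutoff, hmax,
        cutoff_unit_of_lt ((WithBot.coe_lt_coe.2 he).trans_le (le_max_left _ _)), zero_add]
      exact h₃' (max b (max a e)) ((le_max_left _ _).trans (le_max_right _ _)) (le_max_left _ _)

end DecreasingDiagrams

end CHR

namespace CHR

open FirstOrder

/-! ### Free variables, renaming and evaluation -/

section Variables

variable {L : FirstOrder.Language.{u, v}}

theorem Term.mem_varFinset_relabel {α β : Type*} [DecidableEq α] [DecidableEq β] (g : α → β)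
    (t : L.Term α) (x : β) : x ∈ (t.relabel g).varFinset ↔ ∃ y ∈ t.varFinset, g y = x := by
  induction t with
  | var a => simp [Language.Term.relabel, Language.Term.varFinset, eq_comm]
  | func f ts ih =>
    simp only [Language.Term.relabel, Language.Term.varFinset, Finset.mem_biUnion, ih]
    grind

theorem Term.mem_varFinsetLeft_relabel {α α' β β' : Type*} [DecidableEq α] [DecidableEq α']
    (g : α ⊕ β → α' ⊕ β') (h : ∀ b : β, ∃ b', g (Sum.inr b) = Sum.inr b')
    (t : L.Term (α ⊕ β)) (x : α') :
    x ∈ (t.relabel g).varFinsetLeft → ∃ y ∈ t.varFinsetLeft, g (Sum.inl y) = Sum.inl x := by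
  induction t with
  | var a =>
    rcases a with a | b
    · simp only [Language.Term.relabel, Language.Term.varFinsetLeft]
      rcases hg : g (Sum.inl a) with a' | b' <;>
        simp [Language.Term.varFinsetLeft, hg, eq_comm]
    · obtain ⟨b', hb⟩ := h b
      simp [Language.Term.relabel, Language.Term.varFinsetLeft, hb]
  | func f ts ih =>
    simp only [Language.Term.relabel, Language.Term.varFinsetLeft, Finset.mem_biUnion]
    rintro ⟨i, -, hi⟩
    obtain ⟨y, hy, hg⟩ := ih i hi
    exact ⟨y, ⟨i, Finset.mem_univ i, hy⟩, hg⟩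

theorem Term.varFinsetLeft_relabel_inl {α β : Type*} [DecidableEq α] (t : L.Term α) :
    (t.relabel (Sum.inl : α → α ⊕ β)).varFinsetLeft = t.varFinset := by
  induction t with
  | var a => rfl
  | func f ts ih =>
    simp only [Language.Term.relabel, Language.Term.varFinsetLeft, Language.Term.varFinset, ih]

/-- Only this inclusion is needed: renamed constraints must not acquire unexpected variables.
Relabeling sends bound variables to bound ones, so each free variable of the result comes from a
free variable. -/
theorem BoundedFormula.mem_freeVarFinset_relabel {α β : Type*} [DecidableEq α] [DecidableEq β]
    (g : α → β) {n : ℕ} (φ : L.BoundedFormula α n) (x : β) :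
    x ∈ (Language.BoundedFormula.relabel (n := 0) (Sum.inl ∘ g) φ).freeVarFinset →
      ∃ y ∈ φ.freeVarFinset, g y = x := by
  have aux : ∀ {n : ℕ} (t : L.Term (α ⊕ Fin n)) (x : β),
      x ∈ (t.relabel (Language.BoundedFormula.relabelAux (n := 0) (Sum.inl ∘ g) n)).varFinsetLeft →
        ∃ y ∈ t.varFinsetLeft, g y = x := by
    intro n t x hx
    obtain ⟨y, hy, h⟩ := Term.mem_varFinsetLeft_relabel
      (Language.BoundedFormula.relabelAux (n := 0) (Sum.inl ∘ g) n) (fun b => ⟨_, rfl⟩) t x hx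
    refine ⟨y, hy, ?_⟩
    simpa [Language.BoundedFormula.relabelAux] using h
  induction φ with
  | falsum => intro h; simp [Language.BoundedFormula.freeVarFinset] at h
  | equal t₁ t₂ =>
    simp only [Language.BoundedFormula.relabel, Language.BoundedFormula.mapTermRel,
      Language.BoundedFormula.freeVarFinset, Finset.mem_union]
    rintro (h | h)
    · obtain ⟨y, hy, h⟩ := aux _ _ h; exact ⟨y, Or.inl hy, h⟩
    · obtain ⟨y, hy, h⟩ := aux _ _ h; exact ⟨y, Or.inr hy, h⟩
  | rel R ts =>
    simp only [Language.BoundedFormula.relabel, Language.BoundedFormula.mapTermRel,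
      Language.BoundedFormula.freeVarFinset, Finset.mem_biUnion]
    rintro ⟨i, -, h⟩
    obtain ⟨y, hy, h⟩ := aux _ _ h
    exact ⟨y, ⟨i, Finset.mem_univ i, hy⟩, h⟩
  | imp φ ψ ih₁ ih₂ =>
    simp only [Language.BoundedFormula.relabel_imp, Language.BoundedFormula.freeVarFinset,
      Finset.mem_union]
    rintro (h | h)
    · obtain ⟨y, hy, h⟩ := ih₁ h; exact ⟨y, Or.inl hy, h⟩
    · obtain ⟨y, hy, h⟩ := ih₂ h; exact ⟨y, Or.inr hy, h⟩
  | all φ ih =>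
    simp only [Language.BoundedFormula.relabel_all, Language.BoundedFormula.freeVarFinset]
    exact ih

theorem Term.realize_congr {α : Type*} [DecidableEq α] {M : Type*} [L.Structure M] (t : L.Term α)
    {v v' : α → M} (h : ∀ x ∈ t.varFinset, v x = v' x) : t.realize v = t.realize v' := by
  rw [← Language.Term.realize_restrictVar (t := t) (f := Subtype.val) (v := v) v fun _ => rfl]
  exact Language.Term.realize_restrictVar v' fun a => h a.1 a.2

theorem Formula.realize_congr {α : Type*} [DecidableEq α] {M : Type*} [L.Structure M]
    (φ : L.Formula α) {v v' : α → M}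
    (h : ∀ x ∈ Language.BoundedFormula.freeVarFinset φ, v x = v' x) :
    φ.Realize v ↔ φ.Realize v' := by
  unfold Language.Formula.Realize
  rw [← Language.BoundedFormula.realize_restrictFreeVar (φ := φ) (f := Subtype.val) (v := v) v
    (fun _ => rfl)]
  exact Language.BoundedFormula.realize_restrictFreeVar v' (fun a => h a.1 a.2)

variable {C : ConstraintLanguage L} {Pred : ℕ → Type w} {R : Type z}

theorem Multiset.mem_sup_finset {α : Type*} [DecidableEq α] (s : Multiset (Finset α)) (x : α) :
    x ∈ s.sup ↔ ∃ t ∈ s, x ∈ t := by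
  induction s using Multiset.induction with
  | empty => simp
  | cons a s ih => simp [ih]

theorem mem_atomsFv {A : Multiset (Atom L Pred)} {x : ℕ} :
    x ∈ atomsFv A ↔ ∃ a ∈ A, x ∈ a.fv := by
  simp [atomsFv, Multiset.mem_sup_finset]

@[simp]
theorem atomsFv_add (A B : Multiset (Atom L Pred)) : atomsFv (A + B) = atomsFv A ∪ atomsFv B := by
  simp [atomsFv]

theorem Conj.mem_fv {D : Conj C} {x : ℕ} : x ∈ Conj.fv D ↔ ∃ c ∈ D, x ∈ c.fv := by
  simp [Conj.fv, Multiset.mem_sup_finset]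

@[simp]
theorem Conj.fv_add (D D' : Conj C) : Conj.fv (D + D') = Conj.fv D ∪ Conj.fv D' := by
  simp [Conj.fv]

theorem Atom.mem_fv {a : Atom L Pred} {x : ℕ} :
    x ∈ a.fv ↔ ∃ i, x ∈ (a.args i).varFinset := by simp [Atom.fv]

theorem Atom.mem_fv_rename {ρ : Equiv.Perm ℕ} {a : Atom L Pred} {x : ℕ} :
    x ∈ (a.rename ρ).fv ↔ ∃ y ∈ a.fv, ρ y = x := by
  simp only [Atom.mem_fv, Atom.rename, Term.mem_varFinset_relabel]
  grind

theorem mem_atomsFv_rename {ρ : Equiv.Perm ℕ} {A : Multiset (Atom L Pred)} {x : ℕ} :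
    x ∈ atomsFv (atomsRename ρ A) ↔ ∃ y ∈ atomsFv A, ρ y = x := by
  simp only [mem_atomsFv, atomsRename, Multiset.mem_map]
  constructor
  · rintro ⟨_, ⟨a, ha, rfl⟩, hx⟩
    obtain ⟨y, hy, h⟩ := Atom.mem_fv_rename.1 hx
    exact ⟨y, ⟨a, ha, hy⟩, h⟩
  · rintro ⟨y, ⟨a, ha, hy⟩, h⟩
    exact ⟨_, ⟨a, ha, rfl⟩, Atom.mem_fv_rename.2 ⟨y, hy, h⟩⟩

theorem Conj.exists_of_mem_fv_rename {ρ : Equiv.Perm ℕ} {D : Conj C} {x : ℕ}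
    (h : x ∈ Conj.fv (D.rename ρ)) : ∃ y ∈ D.fv, ρ y = x := by
  obtain ⟨_, hc', hx⟩ := Conj.mem_fv.1 h
  obtain ⟨c, hc, rfl⟩ := Multiset.mem_map.1 hc'
  obtain ⟨y, hy, h⟩ := BoundedFormula.mem_freeVarFinset_relabel ρ c.1 x hx
  exact ⟨y, Conj.mem_fv.2 ⟨c, hc, hy⟩, h⟩

@[simp]
theorem Conj.holds_add {D D' : Conj C} {M : Type*} [L.Structure M] {val : ℕ → M} :
    Conj.Holds (D + D') val ↔ D.Holds val ∧ D'.Holds val := by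
  simp [Conj.Holds, or_imp, forall_and]

theorem Conj.Holds.mono {D D' : Conj C} {M : Type*} [L.Structure M] {val : ℕ → M}
    (h : D'.Holds val) (hle : D ≤ D') : D.Holds val :=
  fun c hc => h c (Multiset.mem_of_le hle hc)

theorem Conj.holds_congr {D : Conj C} {M : Type*} [L.Structure M] {val val' : ℕ → M}
    (h : ∀ x ∈ D.fv, val x = val' x) : D.Holds val ↔ D.Holds val' :=
  forall₂_congr fun c hc => Formula.realize_congr c.1 fun x hx => h x (Conj.mem_fv.2 ⟨c, hc, hx⟩)

theorem Conj.holds_rename {ρ : Equiv.Perm ℕ} {D : Conj C} {M : Type*} [L.Structure M]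
    {val : ℕ → M} : (D.rename ρ).Holds val ↔ D.Holds (val ∘ ρ) := by
  simp only [Conj.Holds, Conj.rename, Multiset.forall_mem_map_iff]
  exact forall₂_congr fun c _ => Language.Formula.realize_relabel

/-- The ground atom denoted by an atom under a valuation. -/
def Atom.eval {M : Type*} [L.Structure M] (val : ℕ → M) (a : Atom L Pred) :
    Σ n, Pred n × (Fin n → M) := ⟨a.arity, a.pred, fun i => (a.args i).realize val⟩

theorem Atom.eval_congr {a : Atom L Pred} {M : Type*} [L.Structure M] {val val' : ℕ → M}
    (h : ∀ x ∈ a.fv, val x = val' x) : a.eval val = a.eval val' := by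
  unfold Atom.eval
  congr 2
  exact funext fun i => Term.realize_congr _ fun x hx => h x (Atom.mem_fv.2 ⟨i, hx⟩)

theorem Atom.eval_rename {a : Atom L Pred} {ρ : Equiv.Perm ℕ} {M : Type*} [L.Structure M]
    {val : ℕ → M} : (a.rename ρ).eval val = a.eval (val ∘ ρ) := by
  simp [Atom.eval, Atom.rename, Language.Term.realize_relabel]

theorem AtomEq.holds_conj {e : AtomEq L Pred} {M : Type*} [L.Structure M] {val : ℕ → M} :
    (e.conj C).Holds val ↔ e.lhs.eval val = e.rhs.eval val := by
  simp [Conj.Holds, AtomEq.conj, Atom.eval, AtomEq.lhs, AtomEq.rhs, Constraint.equal, funext_iff,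
    Language.Formula.realize_equal]

theorem AtomEq.fv_conj {e : AtomEq L Pred} : (e.conj C).fv = e.lhs.fv ∪ e.rhs.fv := by
  ext x
  simp [Conj.mem_fv, AtomEq.conj, Constraint.fv, Constraint.equal, Atom.mem_fv, AtomEq.lhs,
    AtomEq.rhs, Language.Term.equal, Language.Term.bdEqual,
    Language.BoundedFormula.freeVarFinset, Term.varFinsetLeft_relabel_inl, exists_or]

theorem matchConj_add (m m' : Multiset (AtomEq L Pred)) :
    matchConj C (m + m') = matchConj C m + matchConj C m' := by simp [matchConj]

theorem matchConj_cons (e : AtomEq L Pred) (m : Multiset (AtomEq L Pred)) :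
    matchConj C (e ::ₘ m) = e.conj C + matchConj C m := by simp [matchConj]

theorem holds_matchConj {m : Multiset (AtomEq L Pred)} {M : Type*} [L.Structure M] {val : ℕ → M} :
    (matchConj C m).Holds val ↔ ∀ e ∈ m, e.lhs.eval val = e.rhs.eval val := by
  induction m using Multiset.induction with
  | empty => simp [matchConj, Conj.Holds]
  | cons e m ih => simp [matchConj_cons, AtomEq.holds_conj, ih]

theorem fv_matchConj (m : Multiset (AtomEq L Pred)) :
    (matchConj C m).fv = atomsFv (m.map AtomEq.lhs) ∪ atomsFv (m.map AtomEq.rhs) := by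
  induction m using Multiset.induction with
  | empty => rfl
  | cons e m ih =>
    rw [matchConj_cons, Conj.fv_add, ih, AtomEq.fv_conj]
    ext x
    simp only [Finset.mem_union, mem_atomsFv, Multiset.map_cons, Multiset.mem_cons,
      exists_eq_or_imp]
    constructor <;> rintro ((h | h) | (h | h)) <;> simp only [h, true_or, or_true]

/-- A permutation that fixes `X` and moves the other elements of `V` out of `Z`. -/
theorem exists_fresh (X V Z : Finset ℕ) :
    ∃ ρ : Equiv.Perm ℕ, (∀ x ∈ X, ρ x = x) ∧ ∀ x ∈ V, x ∉ X → ρ x ∉ Z := by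
  obtain ⟨N, hN⟩ : ∃ N, ∀ x ∈ X ∪ V ∪ Z, x < N :=
    ⟨(X ∪ V ∪ Z).sup id + 1, fun x hx => Nat.lt_succ_of_le (Finset.le_sup (f := id) hx)⟩
  let A := V \ X
  -- Since `N` exceeds every variable in sight, exchanging each `n` in `A` with `n + N` is an
  -- involution, and it moves `A` out of `Z`.
  let f : ℕ → ℕ := fun n => if n ∈ A then n + N else if N ≤ n ∧ n - N ∈ A then n - N else n
  have hA : ∀ x ∈ A, x < N := fun x hx => hN x (by simp [A] at hx; simp [hx])
  have hf : Function.Involutive f := by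
    intro n
    by_cases h1 : n ∈ A
    · have h2 : n + N ∉ A := fun h => by have := hA _ h; omega
      simp [f, h1, h2]
    · by_cases h2 : N ≤ n ∧ n - N ∈ A
      · simp [f, h1, h2]
      · simp [f, h1, h2]
  refine ⟨hf.toPerm f, fun x hx => ?_, fun x hx hx' hz => ?_⟩
  · have h1 : x ∉ A := by simp [A, hx]
    have h2 : x < N := hN x (by simp [hx])
    change f x = x
    simp only [f, if_neg h1]
    rw [if_neg (by omega)]
  · have h1 : x ∈ A := by simp [A, hx, hx']
    have h2 := hN _ (Finset.mem_union_right _ hz)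
    change f x < N at h2
    simp only [f, if_pos h1] at h2
    omega

end Variables

end CHR

namespace CHR

open FirstOrder

/-! ### Denotations of states, and their soundness and completeness for state equivalence -/

section Semantics

variable {L : FirstOrder.Language.{u, v}} {C : ConstraintLanguage L} {Pred : ℕ → Type w}
  {CT : L.Theory}

/-- A list of atoms with a constraint `D` and global variables `X` denotes, under a valuation `g` of
the global variables, a set of lists of ground atoms. -/
def Denotes (l : List (Atom L Pred)) (D : Conj C) (X : Finset ℕ) {M : Type*} [L.Structure M]
    (g : ℕ → M) (w : List (Σ n, Pred n × (Fin n → M))) : Prop :=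
  ∃ val : ℕ → M, (∀ x ∈ X, val x = g x) ∧ D.Holds val ∧ l.map (Atom.eval val) = w

/-- Lists are compared instead of multisets, so that equal denotations pair the atoms position by
position. The same pairing then works for all models and valuations. -/
def SameDenotation (CT : L.Theory) (l : List (Atom L Pred)) (D : Conj C) (X : Finset ℕ)
    (l' : List (Atom L Pred)) (D' : Conj C) (X' : Finset ℕ) : Prop :=
  ∀ (M : FirstOrder.Language.Theory.ModelType.{u, v, max u v} CT) (g : ℕ → M)
    (w : List (Σ n, Pred n × (Fin n → M))), Denotes l D X g w ↔ Denotes l' D' X' g w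

theorem SameDenotation.symm {l l' : List (Atom L Pred)} {D D' : Conj C} {X X' : Finset ℕ}
    (h : SameDenotation CT l D X l' D' X') : SameDenotation CT l' D' X' l D X :=
  fun M g w => (h M g w).symm

theorem SameDenotation.trans {l l' l'' : List (Atom L Pred)} {D D' D'' : Conj C}
    {X X' X'' : Finset ℕ} (h : SameDenotation CT l D X l' D' X')
    (h' : SameDenotation CT l' D' X' l'' D'' X'') : SameDenotation CT l D X l'' D'' X'' :=
  fun M g w => (h M g w).trans (h' M g w)

/-- A solution of one store serves as the valuation `g` of the global variables, and the other
presentation reproduces the same ground atoms. -/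
theorem SameDenotation.exists_val {l l' : List (Atom L Pred)} {D D' : Conj C} {X X' : Finset ℕ}
    (h : SameDenotation CT l D X l' D' X')
    (M : FirstOrder.Language.Theory.ModelType.{u, v, max u v} CT) {val : ℕ → M}
    (hval : D.Holds val) : ∃ val' : ℕ → M, (∀ x ∈ X', val' x = val x) ∧ D'.Holds val' ∧
      l'.map (Atom.eval val') = l.map (Atom.eval val) :=
  (h M val _).1 ⟨val, fun _ _ => rfl, hval, rfl⟩

theorem map_eval_congr {l : List (Atom L Pred)} {M : Type*} [L.Structure M] {val val' : ℕ → M}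
    (h : ∀ x ∈ atomsFv (l : Multiset (Atom L Pred)), val x = val' x) :
    l.map (Atom.eval val) = l.map (Atom.eval val') :=
  List.map_congr_left fun a ha => Atom.eval_congr fun x hx =>
    h x (mem_atomsFv.2 ⟨a, Multiset.mem_coe.2 ha, hx⟩)

theorem not_satisfiable_falsum : ¬ Conj.Satisfiable CT ({Constraint.falsum} : Conj C) := by
  rintro ⟨M, val, h⟩
  exact h _ (Multiset.mem_singleton_self _)

theorem Conj.Satisfiable.mono {D D' : Conj C} (h : Conj.Satisfiable CT D') (hle : D ≤ D') :
    D.Satisfiable CT := by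
  obtain ⟨M, val, h⟩ := h
  exact ⟨M, val, h.mono hle⟩

/-- `T` denotes the same as `S`, up to the order of atoms. -/
def SemLE (CT : L.Theory) (S T : PreState C Pred) : Prop :=
  (S.builtin.Satisfiable CT ↔ T.builtin.Satisfiable CT) ∧
  (S.builtin.Satisfiable CT → ∀ l : List (Atom L Pred), (l : Multiset (Atom L Pred)) = S.user →
    ∃ l' : List (Atom L Pred), (l' : Multiset (Atom L Pred)) = T.user ∧
      SameDenotation CT l S.builtin S.globals l' T.builtin T.globals)

theorem SemLE.trans {S T U : PreState C Pred} (h : SemLE CT S T) (h' : SemLE CT T U) :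
    SemLE CT S U := by
  refine ⟨h.1.trans h'.1, fun hs l hl => ?_⟩
  obtain ⟨l', hl', h1⟩ := h.2 hs l hl
  obtain ⟨l'', hl'', h2⟩ := h'.2 (h.1.1 hs) l' hl'
  exact ⟨l'', hl'', h1.trans h2⟩

theorem SemLE.refl (S : PreState C Pred) : SemLE CT S S :=
  ⟨Iff.rfl, fun _ l hl => ⟨l, hl, fun _ _ _ => Iff.rfl⟩⟩

theorem Conj.EquivOver.symm {X : Finset ℕ} {D D' : Conj C} (h : Conj.EquivOver CT X D D') :
    Conj.EquivOver CT X D' D := fun M val => (h M val).symm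

theorem Conj.EquivOver.satisfiable {X : Finset ℕ} {D D' : Conj C} (h : Conj.EquivOver CT X D D')
    (hD : D.Satisfiable CT) : D'.Satisfiable CT := by
  obtain ⟨M, val, hv⟩ := hD
  obtain ⟨val', -, h'⟩ := (h M val).1 ⟨val, fun _ _ => rfl, hv⟩
  exact ⟨M, val', h'⟩

theorem Conj.EquivOver.denotes {l : List (Atom L Pred)} {X : Finset ℕ} {D D' : Conj C}
    (h : Conj.EquivOver CT (atomsFv (l : Multiset (Atom L Pred)) ∪ X) D D')
    (M : FirstOrder.Language.Theory.ModelType.{u, v, max u v} CT) {g : ℕ → M}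
    {w : List (Σ n, Pred n × (Fin n → M))} (hd : Denotes l D X g w) : Denotes l D' X g w := by
  obtain ⟨val, hg, hv, rfl⟩ := hd
  obtain ⟨val', ha, h'⟩ := (h M val).1 ⟨val, fun _ _ => rfl, hv⟩
  exact ⟨val', fun x hx => (ha x (Finset.mem_union_right _ hx)).trans (hg x hx), h',
    map_eval_congr fun x hx => ha x (Finset.mem_union_left _ hx)⟩

theorem semLE_builtin (A : Multiset (Atom L Pred)) {D D' : Conj C} {X : Finset ℕ}
    (h : Conj.EquivOver CT (atomsFv A ∪ X) D D') : SemLE CT ⟨A, D, X⟩ ⟨A, D', X⟩ := by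
  refine ⟨⟨h.satisfiable, h.symm.satisfiable⟩, fun _ l hl => ⟨l, hl, fun M g w => ?_⟩⟩
  cases hl
  exact ⟨h.denotes M, h.symm.denotes M⟩

theorem semLE_equality (A : Multiset (Atom L Pred)) (D : Conj C) (a b : Atom L Pred) (X : Finset ℕ)
    (h : ∀ (M : FirstOrder.Language.Theory.ModelType.{u, v, max u v} CT) (val : ℕ → M),
      D.Holds val → a.eval val = b.eval val) :
    SemLE CT ⟨A + {a}, D, X⟩ ⟨A + {b}, D, X⟩ := by
  refine ⟨Iff.rfl, fun _ l hl => ?_⟩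
  obtain ⟨s, t, rfl⟩ := List.append_of_mem (a := a) (l := l)
    (by rw [← Multiset.mem_coe, hl]; simp)
  refine ⟨s ++ b :: t, ?_, fun M g w => ?_⟩
  · change _ = A + {b}
    change _ = A + {a} at hl
    simp only [← Multiset.coe_add, ← Multiset.cons_coe, ← Multiset.singleton_add] at hl ⊢
    have : A = ↑s + ↑t := by
      apply add_right_cancel (b := ({a} : Multiset (Atom L Pred)))
      rw [← hl]; abel
    rw [this]; abel
  · refine exists_congr fun val => and_congr_right fun _ => and_congr_right fun hv => ?_
    simp [h M val hv]

theorem semLE_omission (A : Multiset (Atom L Pred)) (D : Conj C) (X : Finset ℕ) {y : ℕ}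
    (hy : y ∉ atomsFv A ∪ D.fv) : SemLE CT ⟨A, D, X⟩ ⟨A, D, insert y X⟩ ∧
      SemLE CT ⟨A, D, insert y X⟩ ⟨A, D, X⟩ := by
  rw [Finset.mem_union, not_or] at hy
  have key : ∀ l : List (Atom L Pred), (l : Multiset (Atom L Pred)) = A →
      SameDenotation CT l D X l D (insert y X) := by
    rintro l rfl M g w
    constructor
    · rintro ⟨val, hg, hv, rfl⟩
      have hne : ∀ x, x ≠ y → Function.update val y (g y) x = val x := fun x hx =>
        Function.update_of_ne hx _ _
      refine ⟨Function.update val y (g y), ?_, ?_, ?_⟩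
      -- Since `y` occurs in neither store, its value can be reset to the prescribed `g y`.
      · intro x hx
        by_cases hxy : x = y
        · subst hxy; simp
        · rw [hne x hxy]; exact hg x ((Finset.mem_insert.1 hx).resolve_left hxy)
      · exact (Conj.holds_congr fun x hx => hne x fun h => hy.2 (h ▸ hx)).2 hv
      · exact map_eval_congr fun x hx => hne x fun h => hy.1 (h ▸ hx)
    · rintro ⟨val, hg, hv, rfl⟩
      exact ⟨val, fun x hx => hg x (Finset.mem_insert_of_mem hx), hv, rfl⟩
  exact ⟨⟨Iff.rfl, fun _ l hl => ⟨l, hl, key l hl⟩⟩,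
    ⟨Iff.rfl, fun _ l hl => ⟨l, hl, (key l hl).symm⟩⟩⟩

theorem StateRel.semLE {S T : PreState C Pred} (h : StateRel CT S T) :
    SemLE CT S T ∧ SemLE CT T S := by
  cases h with
  | builtin A D D' X h => exact ⟨semLE_builtin A h, semLE_builtin A h.symm⟩
  | failed A A' X X' =>
    exact ⟨⟨Iff.rfl, fun h => absurd h not_satisfiable_falsum⟩,
      ⟨Iff.rfl, fun h => absurd h not_satisfiable_falsum⟩⟩
  | equality A D e X =>
    have h : ∀ (M : FirstOrder.Language.Theory.ModelType.{u, v, max u v} CT) (val : ℕ → M),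
        (D + e.conj C).Holds val → e.lhs.eval val = e.rhs.eval val :=
      fun M val hv => AtomEq.holds_conj.1 (Conj.holds_add.1 hv).2
    exact ⟨semLE_equality A _ _ _ X h, semLE_equality A _ _ _ X fun M val hv => (h M val hv).symm⟩
  | omission A D X y hy => exact semLE_omission A D X hy

theorem semLE_of_eqvGen {S T : PreState C Pred} (h : Relation.EqvGen (StateRel CT) S T) :
    SemLE CT S T ∧ SemLE CT T S := by
  induction h with
  | rel _ _ h => exact h.semLE
  | refl => exact ⟨.refl _, .refl _⟩
  | symm _ _ _ ih => exact ih.symm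
  | trans _ _ _ _ _ ih₁ ih₂ => exact ⟨ih₁.1.trans ih₂.1, ih₂.2.trans ih₁.2⟩

theorem semLE_of_mkState_eq {A A' : Multiset (Atom L Pred)} {D D' : Conj C} {X X' : Finset ℕ}
    (h : mkState CT A D X = mkState CT A' D' X') : SemLE CT ⟨A, D, X⟩ ⟨A', D', X'⟩ :=
  (semLE_of_eqvGen (Quotient.exact h)).1

theorem satisfiable_iff_of_mkState_eq {A A' : Multiset (Atom L Pred)} {D D' : Conj C}
    {X X' : Finset ℕ} (h : mkState CT A D X = mkState CT A' D' X') :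
    D.Satisfiable CT ↔ D'.Satisfiable CT := (semLE_of_mkState_eq h).1

theorem mkState_eq_of_rel {A A' : Multiset (Atom L Pred)} {D D' : Conj C} {X X' : Finset ℕ}
    (h : StateRel CT ⟨A, D, X⟩ ⟨A', D', X'⟩) : mkState CT A D X = mkState CT A' D' X' :=
  Quotient.sound (Relation.EqvGen.rel _ _ h)

theorem mkState_eq_failedState {A : Multiset (Atom L Pred)} {D : Conj C} {X : Finset ℕ}
    (h : ¬ D.Satisfiable CT) : mkState CT A D X = failedState CT C Pred := by
  refine (mkState_eq_of_rel (.builtin A D {Constraint.falsum} X fun M val => ?_)).trans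
    (mkState_eq_of_rel (.failed A 0 X ∅))
  exact ⟨fun ⟨val', _, h'⟩ => absurd ⟨M, val', h'⟩ h,
    fun ⟨val', _, h'⟩ => absurd ⟨M, val', h'⟩ not_satisfiable_falsum⟩

theorem mkState_eq_failedState_iff {A : Multiset (Atom L Pred)} {D : Conj C} {X : Finset ℕ} :
    mkState CT A D X = failedState CT C Pred ↔ ¬ D.Satisfiable CT :=
  ⟨fun h h' => not_satisfiable_falsum ((satisfiable_iff_of_mkState_eq h).1 h'),
    mkState_eq_failedState⟩

theorem mkState_matchConj (A : Multiset (Atom L Pred)) (D : Conj C) (m : Multiset (AtomEq L Pred))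
    (X : Finset ℕ) : mkState CT (A + m.map AtomEq.lhs) (D + matchConj C m) X =
      mkState CT (A + m.map AtomEq.rhs) (D + matchConj C m) X := by
  induction m using Multiset.induction generalizing A D with
  | empty => rfl
  | cons e m ih =>
    have h1 := ih (A + {e.lhs}) (D + e.conj C)
    have h2 := mkState_eq_of_rel (CT := CT)
      (.equality (A + m.map AtomEq.rhs) (D + matchConj C m) e X)
    simp only [matchConj_cons, Multiset.map_cons]
    simp only [← Multiset.singleton_add, add_assoc] at h1 h2 ⊢
    rw [h1, add_comm (e.conj C), add_comm ({e.lhs} : Multiset (Atom L Pred)), h2,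
      add_comm ({e.rhs} : Multiset (Atom L Pred))]

/-- Equations that occur in the built-in store can be applied to the user store. -/
theorem mkState_rewrite {A A' : Multiset (Atom L Pred)} {D : Conj C} {m : Multiset (AtomEq L Pred)}
    (X : Finset ℕ) (B : Multiset (Atom L Pred)) (hA : A = B + m.map AtomEq.lhs)
    (hA' : A' = B + m.map AtomEq.rhs) (hD : matchConj C m ≤ D) :
    mkState CT A D X = mkState CT A' D X := by
  obtain ⟨D', rfl⟩ := Multiset.le_iff_exists_add.1 hD
  rw [hA, hA', add_comm (matchConj C m), mkState_matchConj]

theorem mkState_union_globals (A : Multiset (Atom L Pred)) (D : Conj C) (X Y : Finset ℕ)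
    (h : ∀ y ∈ Y, y ∈ atomsFv A ∪ D.fv → y ∈ X) :
    mkState CT A D X = mkState CT A D (X ∪ Y) := by
  induction Y using Finset.induction with
  | empty => simp
  | insert y Y _ ih =>
    rw [ih fun z hz => h z (Finset.mem_insert_of_mem hz), Finset.union_insert]
    by_cases hy : y ∈ X
    · rw [Finset.insert_eq_of_mem (Finset.mem_union_left _ hy)]
    · exact mkState_eq_of_rel (.omission A D _ y fun h' => hy (h y (Finset.mem_insert_self _ _) h'))

/-- Constraints that are implied, up to a choice of fresh variables, can be added to the built-in
store. -/
theorem mkState_absorb (A : Multiset (Atom L Pred)) (D D' : Conj C) (X : Finset ℕ)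
    (h : ∀ (M : FirstOrder.Language.Theory.ModelType.{u, v, max u v} CT) (val : ℕ → M),
      D.Holds val → ∃ val' : ℕ → M, (∀ x ∈ atomsFv A ∪ D.fv ∪ X, val' x = val x) ∧
        D'.Holds val') :
    mkState CT A D X = mkState CT A (D + D') X := by
  refine mkState_eq_of_rel (.builtin A _ _ X fun M g => ⟨?_, ?_⟩)
  · rintro ⟨val, hg, hv⟩
    obtain ⟨val', ha, hv'⟩ := h M val hv
    refine ⟨val', fun x hx => ?_, Conj.holds_add.2 ⟨?_, hv'⟩⟩
    · rw [← hg x hx]; apply ha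
      simp only [Finset.mem_union] at hx ⊢; tauto
    · exact (Conj.holds_congr fun x hx => ha x (by simp [hx])).2 hv
  · rintro ⟨val, hg, hv⟩
    exact ⟨val, hg, (Conj.holds_add.1 hv).1⟩

/-- Equal ground atoms have the same arity and predicate symbol, so the atoms at corresponding
positions can be the two sides of an equation. -/
theorem exists_atomEqs {M : Type*} [L.Structure M] {val val' : ℕ → M} :
    ∀ {l l' : List (Atom L Pred)}, l.map (Atom.eval val) = l'.map (Atom.eval val') →
      ∃ es : List (AtomEq L Pred), es.map AtomEq.lhs = l ∧ es.map AtomEq.rhs = l'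
  | [], [], _ => ⟨[], rfl, rfl⟩
  | [], _ :: _, h => by simp at h
  | _ :: _, [], h => by simp at h
  | a :: l, a' :: l', h => by
    simp only [List.map_cons, List.cons.injEq] at h
    obtain ⟨es, rfl, rfl⟩ := exists_atomEqs h.2
    obtain ⟨n, p, s⟩ := a
    obtain ⟨n', p', t⟩ := a'
    have h1 := h.1
    simp only [Atom.eval, Sigma.mk.injEq] at h1
    obtain ⟨rfl, h2⟩ := h1
    obtain ⟨rfl, -⟩ := Prod.mk.inj (eq_of_heq h2)
    exact ⟨⟨n, p, s, t⟩ :: es, rfl, rfl⟩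

/-- The valuation that takes its values from `val'` on `V` and from `val` elsewhere. -/
def mergeVal {M : Type*} (V : Finset ℕ) (val' val : ℕ → M) (x : ℕ) : M :=
  if x ∈ V then val' x else val x

theorem mergeVal_of_mem {M : Type*} {V : Finset ℕ} {val' val : ℕ → M} {x : ℕ} (h : x ∈ V) :
    mergeVal V val' val x = val' x := if_pos h

theorem mergeVal_eq {M : Type*} {V : Finset ℕ} {val' val : ℕ → M} {x : ℕ}
    (h : x ∈ V → val' x = val x) : mergeVal V val' val x = val x := by
  unfold mergeVal; split_ifs with h'
  · exact h h'
  · rfl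

/-- A state absorbs the built-in store of another one with the same denotation, provided that the two
share only global variables. -/
theorem mkState_absorb_of_sameDenotation {l l' : List (Atom L Pred)} {D D' : Conj C}
    {X X' : Finset ℕ} (h : SameDenotation CT l D X l' D' X') (m : Multiset (AtomEq L Pred))
    (hm : ∀ (M : FirstOrder.Language.Theory.ModelType.{u, v, max u v} CT) (val : ℕ → M),
      l.map (Atom.eval val) = l'.map (Atom.eval val) → (matchConj C m).Holds val)
    (A : Multiset (Atom L Pred)) (B : Conj C) (Y : Finset ℕ)
    (hV : ∀ x ∈ atomsFv A ∪ D.fv ∪ B.fv ∪ atomsFv (l : Multiset (Atom L Pred)) ∪ Y,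
      x ∈ atomsFv (l' : Multiset (Atom L Pred)) ∪ D'.fv → x ∈ X') :
    mkState CT A (D + B) Y = mkState CT A (D + B + (D' + matchConj C m)) Y := by
  refine mkState_absorb _ _ _ _ fun M val hv => ?_
  obtain ⟨val', ha, hv', hl⟩ := h.exists_val M (Conj.holds_add.1 hv).1
  set V := atomsFv (l' : Multiset (Atom L Pred)) ∪ D'.fv
  have h1 : ∀ x ∈ atomsFv A ∪ D.fv ∪ B.fv ∪ atomsFv (l : Multiset (Atom L Pred)) ∪ Y,
      mergeVal V val' val x = val x := fun x hx => mergeVal_eq fun hx' => ha x (hV x hx hx')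
  have h2 : ∀ x ∈ V, mergeVal V val' val x = val' x := fun x hx => mergeVal_of_mem hx
  refine ⟨mergeVal V val' val, fun x hx => h1 x ?_, Conj.holds_add.2 ⟨?_, hm M _ ?_⟩⟩
  · simp only [Conj.fv_add, Finset.mem_union] at hx ⊢; tauto
  · exact (Conj.holds_congr fun x hx => h2 x (Finset.mem_union_right _ hx)).2 hv'
  · rw [map_eval_congr (val' := val), map_eval_congr (l := l') (val' := val'), hl]
    · exact fun x hx => h2 x (Finset.mem_union_left _ hx)
    · exact fun x hx => h1 x (by simp [hx])

theorem holds_matchConj_coe {es : List (AtomEq L Pred)} {M : Type*} [L.Structure M] {val : ℕ → M} :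
    (matchConj C (es : Multiset (AtomEq L Pred))).Holds val ↔
      (es.map AtomEq.lhs).map (Atom.eval val) = (es.map AtomEq.rhs).map (Atom.eval val) := by
  simp [holds_matchConj]

theorem SameDenotation.exists_atomEqs {l l' : List (Atom L Pred)} {D D' : Conj C}
    {X X' : Finset ℕ} (h : SameDenotation CT l D X l' D' X') (hD : D.Satisfiable CT) :
    ∃ es : List (AtomEq L Pred), es.map AtomEq.lhs = l ∧ es.map AtomEq.rhs = l' := by
  obtain ⟨M, val, hv⟩ := hD
  obtain ⟨val', -, -, hl⟩ := h.exists_val M hv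
  exact CHR.exists_atomEqs hl.symm

theorem SameDenotation.satisfiable {l l' : List (Atom L Pred)} {D D' : Conj C}
    {X X' : Finset ℕ} (h : SameDenotation CT l D X l' D' X') (hD : D.Satisfiable CT) :
    D'.Satisfiable CT := by
  obtain ⟨M, val, hv⟩ := hD
  obtain ⟨val', -, h', -⟩ := h.exists_val M hv
  exact ⟨M, val', h'⟩

/-- Each state absorbs the other's built-in store together with the equations between corresponding
atoms. The two built-in stores then agree, the equations rewrite `l` into the other list, and both
sets of global variables can be enlarged to `X ∪ X'`. -/
theorem mkState_eq_of_sameDenotation_of_apart {l l' : List (Atom L Pred)} {D D' : Conj C}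
    {X X' : Finset ℕ} (h : SameDenotation CT l D X l' D' X')
    (h₁ : ∀ x ∈ atomsFv (l : Multiset (Atom L Pred)) ∪ D.fv,
      x ∈ atomsFv (l' : Multiset (Atom L Pred)) ∪ D'.fv ∪ X' → x ∈ X)
    (h₂ : ∀ x ∈ atomsFv (l' : Multiset (Atom L Pred)) ∪ D'.fv,
      x ∈ atomsFv (l : Multiset (Atom L Pred)) ∪ D.fv ∪ X → x ∈ X') :
    mkState (Pred := Pred) CT l D X = mkState CT l' D' X' := by
  by_cases hD : D.Satisfiable CT
  swap
  · rw [mkState_eq_failedState hD, mkState_eq_failedState fun h' => hD (h.symm.satisfiable h')]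
  obtain ⟨es, rfl, rfl⟩ := h.exists_atomEqs hD
  have e₁ := mkState_absorb_of_sameDenotation h (es : Multiset (AtomEq L Pred))
    (fun M val => holds_matchConj_coe.2) (↑(es.map AtomEq.lhs)) 0 (X ∪ X') (by
      intro x hx hx'
      have h0 : x ∉ Conj.fv (0 : Conj C) := Finset.notMem_empty x
      simp only [Finset.mem_union] at hx hx' h₂
      have := h₂ x
      tauto)
  have e₂ := mkState_absorb_of_sameDenotation h.symm (es : Multiset (AtomEq L Pred))
    (fun M val hl => holds_matchConj_coe.2 hl.symm) (↑(es.map AtomEq.rhs)) 0 (X' ∪ X) (by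
      intro x hx hx'
      have h0 : x ∉ Conj.fv (0 : Conj C) := Finset.notMem_empty x
      simp only [Finset.mem_union] at hx hx' h₁
      have := h₁ x
      tauto)
  rw [mkState_union_globals _ D X X', mkState_union_globals _ D' X' X]
  · simp only [add_zero] at e₁ e₂
    rw [e₁, e₂, ← add_assoc, ← add_assoc, add_comm D', Finset.union_comm X']
    exact mkState_rewrite _ 0 (by simp) (by simp) (Multiset.le_add_left _ _)
  · exact fun y hy hy' => h₂ y hy' (Finset.mem_union_right _ hy)
  · exact fun y hy hy' => h₁ y hy' (Finset.mem_union_right _ hy)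

theorem sameDenotation_rename (l : List (Atom L Pred)) (D : Conj C) {X : Finset ℕ}
    {ρ : Equiv.Perm ℕ} (hρ : ∀ x ∈ X, ρ x = x) :
    SameDenotation CT l D X (l.map (Atom.rename ρ)) (D.rename ρ) X := by
  intro M g w
  constructor
  · rintro ⟨val, hg, hv, rfl⟩
    have h : (val ∘ ρ.symm) ∘ ρ = val := by ext x; simp
    refine ⟨val ∘ ρ.symm, fun x hx => ?_, Conj.holds_rename.2 (by rwa [h]), ?_⟩
    · rw [Function.comp_apply, ρ.symm_apply_eq.2 (hρ x hx).symm, hg x hx]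
    · rw [List.map_map]
      exact List.map_congr_left fun a _ => by rw [Function.comp_apply, Atom.eval_rename, h]
  · rintro ⟨val, hg, hv, rfl⟩
    refine ⟨val ∘ ρ, fun x hx => ?_, Conj.holds_rename.1 hv, ?_⟩
    · rw [Function.comp_apply, hρ x hx, hg x hx]
    · rw [List.map_map]
      exact List.map_congr_left fun a _ => by rw [Function.comp_apply, Atom.eval_rename]

theorem exists_of_mem_fv_rename {A : Multiset (Atom L Pred)} {D : Conj C} {ρ : Equiv.Perm ℕ}
    {x : ℕ} (h : x ∈ atomsFv (atomsRename ρ A) ∪ (D.rename ρ).fv) :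
    ∃ y ∈ atomsFv A ∪ D.fv, ρ y = x := by
  rcases Finset.mem_union.1 h with h | h
  · obtain ⟨y, hy, h⟩ := mem_atomsFv_rename.1 h; exact ⟨y, Finset.mem_union_left _ hy, h⟩
  · obtain ⟨y, hy, h⟩ := Conj.exists_of_mem_fv_rename h; exact ⟨y, Finset.mem_union_right _ hy, h⟩

/-- States with the same denotation are equivalent. -/
theorem mkState_eq_of_sameDenotation {l l' : List (Atom L Pred)} {D D' : Conj C}
    {X X' : Finset ℕ} (h : SameDenotation CT l D X l' D' X') :
    mkState (Pred := Pred) CT l D X = mkState CT l' D' X' := by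
  have key : ∀ (l : List (Atom L Pred)) (D : Conj C) (X Z : Finset ℕ), ∃ ρ : Equiv.Perm ℕ,
      SameDenotation CT l D X (l.map (Atom.rename ρ)) (D.rename ρ) X ∧
      mkState (Pred := Pred) CT l D X = mkState CT (l.map (Atom.rename ρ)) (D.rename ρ) X ∧
      ∀ x ∈ atomsFv (l.map (Atom.rename ρ) : Multiset (Atom L Pred)) ∪ (D.rename ρ).fv,
        x ∈ Z → x ∈ X := by
    intro l D X Z
    set V := atomsFv (l : Multiset (Atom L Pred)) ∪ D.fv with hV
    -- `V` is avoided as well, so that the renamed state is apart from the original one and the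
    -- preceding lemma applies to this pair.
    obtain ⟨ρ, hρ, hf⟩ := exists_fresh X V (Z ∪ V)
    have hs := sameDenotation_rename (CT := CT) l D hρ
    have hfr : ∀ x ∈ atomsFv (l.map (Atom.rename ρ) : Multiset (Atom L Pred)) ∪ (D.rename ρ).fv,
        x ∈ Z ∪ V → x ∈ X := by
      intro x hx hz
      obtain ⟨y, hy, rfl⟩ := exists_of_mem_fv_rename (A := (l : Multiset (Atom L Pred))) hx
      by_cases hyX : y ∈ X
      · rwa [hρ y hyX]
      · exact absurd hz (hf y hy hyX)
    refine ⟨ρ, hs, mkState_eq_of_sameDenotation_of_apart hs ?_ ?_, fun x hx hz =>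
      hfr x hx (Finset.mem_union_left _ hz)⟩
    · intro x hx hx'
      rcases Finset.mem_union.1 hx' with hx' | hx'
      · exact hfr x hx' (Finset.mem_union_right _ hx)
      · exact hx'
    · intro x hx hx'
      rcases Finset.mem_union.1 hx' with hx' | hx'
      · exact hfr x hx (Finset.mem_union_right _ hx')
      · exact hx'
  -- The first state is moved away from `X'`, then the second away from `X` and from everything in
  -- the renamed first state.
  obtain ⟨ρ₁, s₁, e₁, f₁⟩ := key l D X X'
  obtain ⟨ρ₂, s₂, e₂, f₂⟩ := key l' D' X' (X ∪ atomsFv (l.map (Atom.rename ρ₁) : Multiset (Atom L Pred)) ∪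
    (D.rename ρ₁).fv)
  rw [e₁, e₂]
  refine mkState_eq_of_sameDenotation_of_apart ((s₁.symm.trans h).trans s₂) ?_ ?_
  · intro x hx hx'
    rcases Finset.mem_union.1 hx' with hx' | hx'
    · exact f₁ x hx (f₂ x hx' (by simp only [Finset.mem_union] at hx ⊢; tauto))
    · exact f₁ x hx hx'
  · intro x hx hx'
    exact f₂ x hx (by simp only [Finset.mem_union] at hx' ⊢; tauto)

theorem mkState_rename (A : Multiset (Atom L Pred)) (D : Conj C) {X : Finset ℕ} {ρ : Equiv.Perm ℕ}
    (hρ : ∀ x ∈ X, ρ x = x) :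
    mkState CT A D X = mkState CT (atomsRename ρ A) (D.rename ρ) X := by
  induction A using Quotient.inductionOn with
  | h l => exact mkState_eq_of_sameDenotation (sameDenotation_rename l D hρ)

/-- The variables that the store `(A, D)` shares with the context `(E, B, Y)` are global. -/
def Apart (A : Multiset (Atom L Pred)) (D : Conj C) (X : Finset ℕ) (E : Multiset (Atom L Pred))
    (B : Conj C) (Y : Finset ℕ) : Prop :=
  ∀ x ∈ atomsFv A ∪ D.fv, x ∈ atomsFv E ∪ B.fv ∪ Y → x ∈ X

/-- A solution of the extended state is changed only on the variables of the replaced part. Those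
shared with the context are global, so they keep their values and the context is unaffected. -/
theorem Denotes.append {l l' s : List (Atom L Pred)} {D D' B : Conj C} {X X' Y : Finset ℕ}
    (h : SameDenotation CT l D X l' D' X') (ha : Apart (↑l') D' X' (s : Multiset (Atom L Pred)) B Y)
    (M : FirstOrder.Language.Theory.ModelType.{u, v, max u v} CT) {g : ℕ → M}
    {w : List (Σ n, Pred n × (Fin n → M))} (hd : Denotes (l ++ s) (D + B) Y g w) :
    Denotes (l' ++ s) (D' + B) Y g w := by
  obtain ⟨val, hg, hv, rfl⟩ := hd
  rw [Conj.holds_add] at hv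
  obtain ⟨val', hX, hv', hl⟩ := h.exists_val M hv.1
  set V := atomsFv (l' : Multiset (Atom L Pred)) ∪ D'.fv
  have h1 : ∀ x ∈ atomsFv (s : Multiset (Atom L Pred)) ∪ B.fv ∪ Y,
      mergeVal V val' val x = val x := fun x hx => mergeVal_eq fun hx' => hX x (ha x hx' hx)
  have h2 : ∀ x ∈ V, mergeVal V val' val x = val' x := fun x hx => mergeVal_of_mem hx
  refine ⟨mergeVal V val' val, fun x hx => ?_, Conj.holds_add.2 ⟨?_, ?_⟩, ?_⟩
  · rw [h1 x (by simp [hx]), hg x hx]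
  · exact (Conj.holds_congr fun x hx => h2 x (Finset.mem_union_right _ hx)).2 hv'
  · exact (Conj.holds_congr fun x hx => h1 x (by simp [hx])).2 hv.2
  · rw [List.map_append, List.map_append,
      map_eval_congr (l := l') fun x hx => h2 x (Finset.mem_union_left _ hx), hl,
      map_eval_congr (l := s) fun x hx => h1 x (by simp [hx])]

/-- This makes extension by a context independent of the representative. For consistent states the
denotation of the whole is determined by that of the part; inconsistency is inherited by the larger
store. -/
theorem mkState_extend_congr {A A' E : Multiset (Atom L Pred)} {D D' B : Conj C}
    {X X' Y : Finset ℕ} (h : mkState CT A D X = mkState CT A' D' X') (ha : Apart A D X E B Y)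
    (ha' : Apart A' D' X' E B Y) : mkState CT (A + E) (D + B) Y = mkState CT (A' + E) (D' + B) Y := by
  by_cases hD : D.Satisfiable CT
  · induction A using Quotient.inductionOn with | h l =>
    induction E using Quotient.inductionOn with | h s =>
    obtain ⟨l', rfl, hs⟩ := (semLE_of_mkState_eq h).2 hD l rfl
    exact mkState_eq_of_sameDenotation (l := l ++ s) (l' := l' ++ s) fun M g w =>
      ⟨Denotes.append hs ha' M, Denotes.append hs.symm ha M⟩
  · have hD' : ¬ D'.Satisfiable CT := fun h' => hD ((satisfiable_iff_of_mkState_eq h).2 h')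
    rw [mkState_eq_failedState fun h' => hD (h'.mono (Multiset.le_add_right _ _)),
      mkState_eq_failedState fun h' => hD' (h'.mono (Multiset.le_add_right _ _))]

theorem exists_apart (S : State CT C Pred) (E : Multiset (Atom L Pred)) (B : Conj C)
    (Y : Finset ℕ) : ∃ A D X, S = mkState CT A D X ∧ Apart A D X E B Y := by
  induction S using Quotient.inductionOn with | h S =>
  obtain ⟨A, D, X⟩ := S
  obtain ⟨ρ, hρ, hf⟩ := exists_fresh X (atomsFv A ∪ D.fv) (atomsFv E ∪ B.fv ∪ Y)
  refine ⟨_, _, X, mkState_rename A D hρ, fun x hx hx' => ?_⟩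
  obtain ⟨y, hy, rfl⟩ := exists_of_mem_fv_rename hx
  by_cases hyX : y ∈ X
  · rwa [hρ y hyX]
  · exact absurd hx' (hf y hy hyX)

/-- The state obtained by adding `E` to the user store and `B` to the built-in store, and by making
`Y` the set of global variables. -/
theorem exists_extend (E : Multiset (Atom L Pred)) (B : Conj C) (Y : Finset ℕ) :
    ∃ f : State CT C Pred → State CT C Pred, ∀ A D X, Apart A D X E B Y →
      f (mkState CT A D X) = mkState CT (A + E) (D + B) Y := by
  -- An arbitrary representative apart from the context is fixed for each class;
  -- `mkState_extend_congr` shows that the choice does not matter.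
  choose A D X h using fun S : State CT C Pred => exists_apart S E B Y
  exact ⟨fun S => mkState CT (A S + E) (D S + B) Y, fun A' D' X' ha =>
    mkState_extend_congr (h _).1.symm (h _).2 ha⟩

end Semantics

end CHR

namespace CHR

open FirstOrder

/-! ### Presentations of transitions with fresh variables -/

section Steps

variable {L : FirstOrder.Language.{u, v}}

/-- For formulas the cast is trivial, so `relabel` becomes a plain `mapTermRel`, for which
composition is available. This is what makes a renaming of a renamed rule a renaming of the original
rule. -/
theorem BoundedFormula.relabel_eq_castLE {α β : Type*} (g : α → β) {n : ℕ}
    (φ : L.BoundedFormula α n) :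
    Language.BoundedFormula.relabel (n := 0) (Sum.inl ∘ g) φ =
      (φ.mapTermRel (g := id) (fun _ t => t.relabel (Sum.map g id)) (fun _ R => R)
        fun _ => id).castLE (Nat.zero_add n).ge := by
  have aux : ∀ {n : ℕ} (t : L.Term (α ⊕ Fin n)),
      t.relabel (Language.BoundedFormula.relabelAux (n := 0) (Sum.inl ∘ g) n) =
        (t.relabel (Sum.map g id)).relabel (Sum.map id (Fin.castLE (Nat.zero_add n).ge)) := by
    intro n t
    rw [Language.Term.relabel_relabel]
    congr 1
    ext x
    rcases x with x | x
    · simp [Language.BoundedFormula.relabelAux]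
    · simp [Language.BoundedFormula.relabelAux, Fin.ext_iff]
  induction φ with
  | falsum => rfl
  | equal t₁ t₂ =>
    simp only [Language.BoundedFormula.relabel, Language.BoundedFormula.mapTermRel,
      Language.BoundedFormula.castLE, aux]
  | rel R ts =>
    simp only [Language.BoundedFormula.relabel, Language.BoundedFormula.mapTermRel,
      Language.BoundedFormula.castLE, aux]
    rfl
  | imp φ ψ ih₁ ih₂ =>
    rw [Language.BoundedFormula.relabel_imp, ih₁, ih₂]
    rfl
  | all φ ih =>
    rw [Language.BoundedFormula.relabel_all, ih]
    rfl

theorem Formula.relabel_eq_mapTermRel {α β : Type*} (g : α → β) (φ : L.Formula α) :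
    φ.relabel g = Language.BoundedFormula.mapTermRel (g := id)
      (fun _ t => t.relabel (Sum.map g id)) (fun _ R => R) (fun _ => id) φ :=
  (BoundedFormula.relabel_eq_castLE g φ).trans (Language.BoundedFormula.castLE_rfl _ _)

theorem Formula.relabel_relabel {α β γ : Type*} (g : α → β) (g' : β → γ) (φ : L.Formula α) :
    (φ.relabel g).relabel g' = φ.relabel (g' ∘ g) := by
  rw [relabel_eq_mapTermRel g', relabel_eq_mapTermRel g, relabel_eq_mapTermRel (g' ∘ g)]
  refine (Language.BoundedFormula.mapTermRel_mapTermRel _ _ _ _ _).trans ?_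
  congr 1
  funext n t
  rw [Function.comp_apply, Language.Term.relabel_relabel, Sum.map_comp_map]
  rfl

variable {C : ConstraintLanguage L} {Pred : ℕ → Type w} {R : Type z} {CT : L.Theory}

theorem atomsRename_atomsRename (ρ ρ' : Equiv.Perm ℕ) (A : Multiset (Atom L Pred)) :
    atomsRename ρ' (atomsRename ρ A) = atomsRename (ρ.trans ρ') A := by
  simp only [atomsRename, Multiset.map_map]
  refine Multiset.map_congr rfl fun a _ => ?_
  simp [Atom.rename, Language.Term.relabel_relabel]

theorem Conj.rename_rename (ρ ρ' : Equiv.Perm ℕ) (D : Conj C) :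
    (D.rename ρ).rename ρ' = D.rename (ρ.trans ρ') := by
  simp only [Conj.rename, Multiset.map_map]
  refine Multiset.map_congr rfl fun c _ => ?_
  exact Subtype.ext (Formula.relabel_relabel _ _ _)

theorem Rule.rename_rename (ρ ρ' : Equiv.Perm ℕ) (r : Rule C Pred R) :
    (r.rename ρ).rename ρ' = r.rename (ρ.trans ρ') := by
  simp only [Rule.rename, atomsRename_atomsRename, Conj.rename_rename]

@[simp]
theorem atomsRename_add (ρ : Equiv.Perm ℕ) (A B : Multiset (Atom L Pred)) :
    atomsRename ρ (A + B) = atomsRename ρ A + atomsRename ρ B := by simp [atomsRename]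

@[simp]
theorem Conj.rename_add (ρ : Equiv.Perm ℕ) (A B : Conj C) :
    Conj.rename ρ (A + B) = Conj.rename ρ A + Conj.rename ρ B := by simp [Conj.rename]

theorem Rule.mem_fv {r : Rule C Pred R} {x : ℕ} : x ∈ r.fv ↔
    x ∈ atomsFv (r.kept + r.removed + r.userBody) ∪ (r.guard + r.builtinBody).fv := by
  simp only [Rule.fv, Rule.headFv, atomsFv_add, Conj.fv_add, Finset.mem_union]; tauto

theorem Rule.mem_headFv_rename {ρ : Equiv.Perm ℕ} {r : Rule C Pred R} {x : ℕ} :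
    x ∈ (r.rename ρ).headFv ↔ ∃ y ∈ r.headFv, ρ y = x := by
  rw [headFv, headFv, ← mem_atomsFv_rename, atomsRename_add]; rfl

theorem Rule.exists_of_mem_fv_rename {ρ : Equiv.Perm ℕ} {r : Rule C Pred R} {x : ℕ}
    (h : x ∈ (r.rename ρ).fv) : ∃ y ∈ r.fv, ρ y = x := by
  rw [Rule.mem_fv] at h
  simp only [Rule.mem_fv (r := r)]
  apply CHR.exists_of_mem_fv_rename
  simp only [atomsRename_add, Conj.rename_add]
  exact h

theorem Rule.exists_of_mem_lv_rename {ρ : Equiv.Perm ℕ} {r : Rule C Pred R} {x : ℕ}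
    (h : x ∈ (r.rename ρ).lv) : ∃ y ∈ r.lv, ρ y = x := by
  rw [Rule.lv, Finset.mem_sdiff] at h
  obtain ⟨y, hy, rfl⟩ := Rule.exists_of_mem_fv_rename h.1
  exact ⟨y, Finset.mem_sdiff.2 ⟨hy, fun hy' => h.2 (mem_headFv_rename.2 ⟨y, hy', rfl⟩)⟩, rfl⟩

theorem Rule.headFv_subset (r : Rule C Pred R) : r.headFv ⊆ r.fv := by
  intro x hx; simp only [Rule.fv, Finset.mem_union]; tauto

theorem Rule.lv_subset (r : Rule C Pred R) : r.lv ⊆ r.fv := Finset.sdiff_subset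

theorem Rule.atomsFv_heads_subset (r : Rule C Pred R) : atomsFv (r.kept + r.removed) ⊆ r.fv :=
  r.headFv_subset

theorem Rule.atomsFv_target_subset (r : Rule C Pred R) :
    atomsFv (r.kept + r.userBody) ⊆ r.fv := by
  intro x hx
  simp only [Rule.mem_fv, atomsFv_add, Finset.mem_union] at hx ⊢; tauto

theorem Rule.fv_guard_subset (r : Rule C Pred R) : r.guard.fv ⊆ r.fv := by
  intro x hx
  simp only [Rule.mem_fv, Conj.fv_add, Finset.mem_union] at hx ⊢; tauto

theorem Rule.fv_builtin_subset (r : Rule C Pred R) : (r.guard + r.builtinBody).fv ⊆ r.fv := by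
  intro x hx
  simp only [Rule.mem_fv, Conj.fv_add, Finset.mem_union] at hx ⊢; tauto

/-- `S` is rewritten to `T` by the renaming `r` of `r₀`, with the stores `E` and `D` as context. -/
structure StepBy (CT : L.Theory) (r₀ : Rule C Pred R) (S T : State CT C Pred) (r : Rule C Pred R)
    (E : Multiset (Atom L Pred)) (D : Conj C) (X : Finset ℕ) : Prop where
  isRenaming : ∃ ρ : Equiv.Perm ℕ, r = r₀.rename ρ
  apart : ∀ x ∈ r.lv, x ∉ atomsFv E ∪ D.fv ∪ X
  source : S = mkState CT (r.kept + r.removed + E) (r.guard + D) X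
  target : T = mkState CT (r.kept + r.userBody + E) (r.guard + r.builtinBody + D) X

theorem step_iff {P : Set (Rule C Pred R)} {S T : State CT C Pred} :
    Step CT P S T ↔ ∃ r₀ ∈ P, ∃ r E D X, StepBy CT r₀ S T r E D X := by
  constructor
  · rintro ⟨r₀, h₀, ρ, r, E, D, X, hr, hd, hS, hT⟩
    exact ⟨r₀, h₀, r, E, D, X, ⟨ρ, hr⟩, fun x hx => Finset.disjoint_left.1 hd hx, hS, hT⟩
  · rintro ⟨r₀, h₀, r, E, D, X, ⟨ρ, hr⟩, hd, hS, hT⟩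
    exact ⟨r₀, h₀, ρ, r, E, D, X, hr, Finset.disjoint_left.2 fun x => hd x, hS, hT⟩

variable {r₀ r : Rule C Pred R} {S T : State CT C Pred} {E : Multiset (Atom L Pred)} {D : Conj C}
  {X : Finset ℕ}

theorem StepBy.rename (h : StepBy CT r₀ S T r E D X) {ρ : Equiv.Perm ℕ} (hρ : ∀ x ∈ X, ρ x = x) :
    StepBy CT r₀ S T (r.rename ρ) (atomsRename ρ E) (D.rename ρ) X where
  isRenaming := by
    obtain ⟨σ, rfl⟩ := h.isRenaming
    exact ⟨_, Rule.rename_rename _ _ _⟩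
  apart := by
    intro x hx hx'
    obtain ⟨y, hy, rfl⟩ := Rule.exists_of_mem_lv_rename hx
    have := h.apart y hy
    simp only [Finset.mem_union, not_or] at this
    rcases Finset.mem_union.1 hx' with hx' | hx'
    · obtain ⟨z, hz, hzy⟩ := exists_of_mem_fv_rename hx'
      rw [ρ.injective hzy] at hz
      simp only [Finset.mem_union] at hz
      tauto
    · rw [ρ.injective (hρ _ hx')] at hx'
      exact this.2 hx'
  source := by
    rw [h.source, mkState_rename _ _ hρ, atomsRename_add, atomsRename_add, Conj.rename_add]; rfl
  target := by
    rw [h.target, mkState_rename _ _ hρ]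
    simp only [atomsRename_add, Conj.rename_add]; rfl

/-- Two steps from the same state can thus be given a common set of global variables. -/
theorem StepBy.union_globals (h : StepBy CT r₀ S T r E D X) {Y : Finset ℕ}
    (hY : ∀ y ∈ Y, y ∈ r.fv ∪ atomsFv E ∪ D.fv → y ∈ X) : StepBy CT r₀ S T r E D (X ∪ Y) where
  isRenaming := h.isRenaming
  apart := by
    intro x hx hx'
    have := h.apart x hx
    have h1 := hY x
    have h2 := r.lv_subset hx
    simp only [Finset.mem_union] at *
    tauto
  source := by
    rw [h.source]
    refine mkState_union_globals _ _ _ _ fun y hy hy' => hY y hy ?_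
    have h1 := @Rule.atomsFv_heads_subset _ _ _ _ r y
    have h2 := @Rule.fv_guard_subset _ _ _ _ r y
    rw [atomsFv_add, Conj.fv_add] at hy'
    simp only [Finset.mem_union] at *
    tauto
  target := by
    rw [h.target]
    refine mkState_union_globals _ _ _ _ fun y hy hy' => hY y hy ?_
    have h1 := @Rule.atomsFv_target_subset _ _ _ _ r y
    have h2 := @Rule.fv_builtin_subset _ _ _ _ r y
    rw [atomsFv_add, Conj.fv_add] at hy'
    simp only [Finset.mem_union] at *
    tauto

/-- The equations `x = ρ x` for `x ∈ H`. -/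
def renamingEqs (C : ConstraintLanguage L) (ρ : Equiv.Perm ℕ) (H : Finset ℕ) : Conj C :=
  H.val.map fun x => Constraint.equal (.var x) (.var (ρ x))

theorem holds_renamingEqs {ρ : Equiv.Perm ℕ} {H : Finset ℕ} {M : Type*} [L.Structure M]
    {val : ℕ → M} : (renamingEqs C ρ H).Holds val ↔ ∀ x ∈ H, val x = val (ρ x) := by
  simp [Conj.Holds, renamingEqs, Constraint.equal, Language.Formula.realize_equal]

theorem mem_fv_renamingEqs {ρ : Equiv.Perm ℕ} {H : Finset ℕ} {x : ℕ}
    (h : x ∈ (renamingEqs C ρ H).fv) : x ∈ H ∨ ∃ y ∈ H, ρ y = x := by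
  simp only [Conj.mem_fv, renamingEqs, Multiset.mem_map, Finset.mem_val] at h
  obtain ⟨_, ⟨y, hy, rfl⟩, hx⟩ := h
  simp only [Constraint.fv, Constraint.equal, Language.Term.equal, Language.Term.bdEqual,
    Language.BoundedFormula.freeVarFinset, Term.varFinsetLeft_relabel_inl,
    Language.Term.varFinset, Finset.mem_union, Finset.mem_singleton] at hx
  rcases hx with rfl | rfl
  · exact Or.inl hy
  · exact Or.inr ⟨y, hy, rfl⟩

/-- The variables `V` of a part of a state can be replaced by fresh ones, if those of them that
also occur elsewhere are equated with their replacements. -/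
theorem mkState_detach (A : Multiset (Atom L Pred)) (G : Conj C) {V H : Finset ℕ}
    {ρ : Equiv.Perm ℕ} (hA : atomsFv A ⊆ V) (hG : G.fv ⊆ V) (hHV : H ⊆ V)
    (hH : ∀ x ∈ V, x ∈ atomsFv E ∪ D.fv ∪ X → x ∈ H)
    (hρ : ∀ x ∈ V, ρ x ∉ V ∪ (atomsFv E ∪ D.fv ∪ X)) :
    mkState CT (A + E) (G + D) X =
      mkState CT (atomsRename ρ A + E) (G.rename ρ + (D + renamingEqs C ρ H)) X := by
  induction A using Quotient.inductionOn with | h l =>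
  induction E using Quotient.inductionOn with | h s =>
  refine mkState_eq_of_sameDenotation (l := l ++ s) (l' := l.map (Atom.rename ρ) ++ s)
    fun M g w => ⟨?_, ?_⟩
  · rintro ⟨val, hg, hv, rfl⟩
    rw [Conj.holds_add] at hv
    -- The witness gives each fresh variable `ρ x` the value of `x` and changes nothing else.
    have h1 : ∀ x ∈ V, mergeVal (V.image ρ) (val ∘ ρ.symm) val (ρ x) = val x := fun x hx => by
      rw [mergeVal_of_mem (Finset.mem_image_of_mem _ hx)]; simp
    have h2 : ∀ x ∈ V ∪ (atomsFv (s : Multiset (Atom L Pred)) ∪ D.fv ∪ X),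
        mergeVal (V.image ρ) (val ∘ ρ.symm) val x = val x := fun x hx => mergeVal_eq fun hx' => by
      obtain ⟨y, hy, rfl⟩ := Finset.mem_image.1 hx'
      exact absurd hx (hρ y hy)
    refine ⟨mergeVal (V.image ρ) (val ∘ ρ.symm) val, fun x hx => ?_, ?_, ?_⟩
    · rw [h2 x (by simp [hx]), hg x hx]
    · rw [Conj.holds_add, Conj.holds_add, Conj.holds_rename, holds_renamingEqs]
      refine ⟨(Conj.holds_congr fun x hx => h1 x (hG hx)).2 hv.1,
        (Conj.holds_congr fun x hx => h2 x (by simp [hx])).2 hv.2, fun x hx => ?_⟩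
      rw [h1 x (hHV hx), h2 x (Finset.mem_union_left _ (hHV hx))]
    · rw [List.map_append, List.map_append, List.map_map]
      congr 1
      · refine List.map_congr_left fun a ha => ?_
        rw [Function.comp_apply, Atom.eval_rename]
        exact Atom.eval_congr fun x hx => h1 x (hA (mem_atomsFv.2 ⟨a, ha, hx⟩))
      · exact map_eval_congr fun x hx => h2 x (by simp [hx])
  · rintro ⟨val, hg, hv, rfl⟩
    rw [Conj.holds_add, Conj.holds_add, Conj.holds_rename, holds_renamingEqs] at hv
    -- Conversely, each `x` in `V` takes the value of its copy `ρ x`. For variables that also occur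
    -- elsewhere the equations make this no change.
    have h1 : ∀ x ∈ V, mergeVal V (val ∘ ρ) val x = (val ∘ ρ) x := fun x hx => mergeVal_of_mem hx
    have h2 : ∀ x ∈ atomsFv (s : Multiset (Atom L Pred)) ∪ D.fv ∪ X,
        mergeVal V (val ∘ ρ) val x = val x := fun x hx => mergeVal_eq fun hx' =>
      (hv.2.2 x (hH x hx' hx)).symm
    refine ⟨mergeVal V (val ∘ ρ) val, fun x hx => ?_, ?_, ?_⟩
    · rw [h2 x (by simp [hx]), hg x hx]
    · rw [Conj.holds_add]
      exact ⟨(Conj.holds_congr fun x hx => h1 x (hG hx)).2 hv.1,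
        (Conj.holds_congr fun x hx => h2 x (by simp [hx])).2 hv.2.1⟩
    · rw [List.map_append, List.map_append, List.map_map]
      congr 1
      · refine List.map_congr_left fun a ha => ?_
        rw [Function.comp_apply, Atom.eval_rename]
        exact Atom.eval_congr fun x hx => h1 x (hA (mem_atomsFv.2 ⟨a, ha, hx⟩))
      · exact map_eval_congr fun x hx => h2 x (by simp [hx])

/-- Only head variables need equations with their fresh copies: local variables of the rule occur
nowhere else. The added equations mention no local variable of the renamed rule, so its side
condition persists. -/
theorem StepBy.detach (h : StepBy CT r₀ S T r E D X) {ρ : Equiv.Perm ℕ}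
    (hρ : ∀ x ∈ r.fv, ρ x ∉ r.fv ∪ (atomsFv E ∪ D.fv ∪ X)) :
    StepBy CT r₀ S T (r.rename ρ) E (D + renamingEqs C ρ r.headFv) X := by
  have hH : ∀ x ∈ r.fv, x ∈ atomsFv E ∪ D.fv ∪ X → x ∈ r.headFv := fun x hx hx' => by
    by_contra hn
    exact h.apart x (Finset.mem_sdiff.2 ⟨hx, hn⟩) hx'
  refine ⟨?_, ?_, ?_, ?_⟩
  · obtain ⟨σ, rfl⟩ := h.isRenaming
    exact ⟨_, Rule.rename_rename _ _ _⟩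
  · intro x hx hx'
    obtain ⟨y, hy, rfl⟩ := Rule.exists_of_mem_lv_rename hx
    have h1 := hρ y (r.lv_subset hy)
    simp only [Conj.fv_add, Finset.mem_union, not_or] at h1 hx'
    rcases hx' with (hx' | hx' | hx') | hx'
    · exact h1.2.1.1 hx'
    · exact h1.2.1.2 hx'
    · rcases mem_fv_renamingEqs hx' with h2 | ⟨z, hz, hzy⟩
      · exact h1.1 (r.headFv_subset h2)
      · rw [ρ.injective hzy] at hz
        exact (Finset.mem_sdiff.1 hy).2 hz
    · exact h1.2.2 hx'
  · rw [h.source, mkState_detach _ _ r.atomsFv_heads_subset r.fv_guard_subset r.headFv_subset hH hρ,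
      atomsRename_add]
    rfl
  · rw [h.target, mkState_detach _ _ r.atomsFv_target_subset r.fv_builtin_subset r.headFv_subset hH
      hρ, atomsRename_add, Conj.rename_add]
    rfl

/-- Any step can be presented in such a way that its variables are as fresh as possible. -/
theorem StepBy.exists_fresh (h : StepBy CT r₀ S T r E D X) {Y : Finset ℕ} (hXY : X ⊆ Y)
    (Z : Finset ℕ) : ∃ r' E' D', StepBy CT r₀ S T r' E' D' Y ∧
      (∀ x ∈ r'.fv, x ∉ Y) ∧ ∀ x ∈ r'.fv ∪ atomsFv E' ∪ D'.fv, x ∈ Z → x ∈ Y := by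
  -- This renaming fixes the global variables `X` and makes all others fresh, which allows the
  -- global variables to be enlarged to `Y`.
  obtain ⟨ρ, hρ, hf⟩ := CHR.exists_fresh X (r.fv ∪ atomsFv E ∪ D.fv) (Y ∪ Z)
  have h₁ := h.rename hρ
  set E₁ := atomsRename ρ E
  set D₁ := D.rename ρ
  set r₁ := r.rename ρ
  have hfr : ∀ x ∈ r₁.fv ∪ atomsFv E₁ ∪ D₁.fv, x ∈ Y ∪ Z → x ∈ X := by
    intro x hx hxY
    obtain ⟨y, hy, rfl⟩ : ∃ y ∈ r.fv ∪ atomsFv E ∪ D.fv, ρ y = x := by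
      simp only [Finset.union_assoc] at hx ⊢
      rcases Finset.mem_union.1 hx with hx | hx
      · obtain ⟨y, hy, h⟩ := Rule.exists_of_mem_fv_rename hx
        exact ⟨y, Finset.mem_union_left _ hy, h⟩
      · obtain ⟨y, hy, h⟩ := exists_of_mem_fv_rename hx
        exact ⟨y, Finset.mem_union_right _ hy, h⟩
    by_cases hyX : y ∈ X
    · rwa [hρ y hyX]
    · exact absurd hxY (hf y hy hyX)
  have h₂ := h₁.union_globals (Y := Y) fun y hy hy' => hfr y hy' (Finset.mem_union_left _ hy)
  rw [Finset.union_eq_right.2 hXY] at h₂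
  -- The rule may still use variables of `X`. A second renaming, which need not fix any variable,
  -- detaches it from the state altogether.
  obtain ⟨σ, -, hσ⟩ := CHR.exists_fresh ∅ r₁.fv (r₁.fv ∪ (atomsFv E₁ ∪ D₁.fv ∪ Y) ∪ Z)
  replace hσ : ∀ x ∈ r₁.fv, σ x ∉ r₁.fv ∪ (atomsFv E₁ ∪ D₁.fv ∪ Y) ∪ Z :=
    fun x hx => hσ x hx (Finset.notMem_empty x)
  have h₃ := h₂.detach (ρ := σ) fun x hx hx' => hσ x hx (Finset.mem_union_left _ hx')
  refine ⟨_, _, _, h₃, ?_, ?_⟩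
  · intro x hx hxY
    obtain ⟨y, hy, rfl⟩ := Rule.exists_of_mem_fv_rename hx
    exact hσ y hy (by simp [hxY])
  · intro x hx hxZ
    have hσZ : ∀ y ∈ r₁.fv, σ y ∉ Z := fun y hy hy' => hσ y hy (Finset.mem_union_right _ hy')
    have key : x ∈ r₁.fv ∪ atomsFv E₁ ∪ D₁.fv → x ∈ Y := fun hx =>
      hXY (hfr x hx (Finset.mem_union_right _ hxZ))
    simp only [Conj.fv_add, Finset.mem_union] at hx key
    rcases hx with (hx | hx) | hx | hx
    · obtain ⟨y, hy, rfl⟩ := Rule.exists_of_mem_fv_rename hx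
      exact absurd hxZ (hσZ y hy)
    · exact key (by tauto)
    · exact key (by tauto)
    · rcases mem_fv_renamingEqs hx with hx | ⟨y, hy, rfl⟩
      · exact key (Or.inl (Or.inl (r₁.headFv_subset hx)))
      · exact absurd hxZ (hσZ y (r₁.headFv_subset hy))

/-- The extension of states by a context is compatible with transitions. -/
theorem exists_extend_step (E : Multiset (Atom L Pred)) (B : Conj C) (Y : Finset ℕ) :
    ∃ f : State CT C Pred → State CT C Pred,
      (∀ A D X, Apart A D X E B Y → f (mkState CT A D X) = mkState CT (A + E) (D + B) Y) ∧
      ∀ (P : Set (Rule C Pred R)) S T, Step CT P S T → Step CT P (f S) (f T) := by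
  obtain ⟨f, hf⟩ := exists_extend (CT := CT) E B Y
  refine ⟨f, hf, fun P S T hST => ?_⟩
  rw [step_iff] at hST ⊢
  obtain ⟨r₀, h₀, r, E₀, D₀, X, h⟩ := hST
  -- In this presentation all variables shared with the new context are global, so both ends of the
  -- step can be extended by the formula for `f`.
  obtain ⟨r', E', D', h', -, ha⟩ := h.exists_fresh (Finset.Subset.refl X) (atomsFv E ∪ B.fv ∪ Y)
  refine ⟨r₀, h₀, r', E' + E, D' + B, Y, h'.isRenaming, fun x hx hx' => ?_, ?_, ?_⟩
  · have h1 := h'.apart x hx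
    have h2 := ha x
    have h3 := r'.lv_subset hx
    simp only [atomsFv_add, Conj.fv_add, Finset.mem_union] at *
    tauto
  · rw [h'.source, hf]
    · simp only [add_assoc]
    intro x hx
    have h1 := @Rule.atomsFv_heads_subset _ _ _ _ r' x
    have h2 := @Rule.fv_guard_subset _ _ _ _ r' x
    refine ha x ?_
    rw [atomsFv_add, Conj.fv_add] at hx
    simp only [Finset.mem_union] at *
    tauto
  · rw [h'.target, hf]
    · simp only [add_assoc]
    intro x hx
    have h1 := @Rule.atomsFv_target_subset _ _ _ _ r' x
    have h2 := @Rule.fv_builtin_subset _ _ _ _ r' x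
    refine ha x ?_
    rw [atomsFv_add, Conj.fv_add] at hx
    simp only [Finset.mem_union] at *
    tauto

end Steps

end CHR

namespace CHR

open FirstOrder

/-! ### Local peaks: commutation or instance of a critical peak -/

section Peaks

theorem Multiset.exists_of_map_eq_add {α β : Type*} (f : α → β) :
    ∀ {s : Multiset α} {A B : Multiset β}, s.map f = A + B →
      ∃ a b, s = a + b ∧ a.map f = A ∧ b.map f = B := by
  classical
  intro s A B h
  induction A using Multiset.induction generalizing s with
  | empty => exact ⟨0, s, by simp, rfl, by simpa using h⟩
  | cons c A ih =>
    rw [Multiset.cons_add] at h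
    obtain ⟨x, hx, rfl, h'⟩ := (Multiset.map_eq_cons _ _ _ _).2 h
    obtain ⟨a, b, hs, rfl, rfl⟩ := ih h'
    exact ⟨x ::ₘ a, b, by rw [Multiset.cons_add, ← hs, Multiset.cons_erase hx], by simp, rfl⟩

theorem Multiset.exists_refinement {α : Type*} {a b c d : Multiset α} (h : a + b = c + d) :
    ∃ p q s t, a = p + q ∧ b = s + t ∧ c = p + s ∧ d = q + t := by
  classical
  have h' := fun x => congrArg (Multiset.count x) h
  simp only [Multiset.count_add] at h'
  refine ⟨a ∩ c, a - c, c - a, b - (c - a), ?_, ?_, ?_, ?_⟩ <;> ext x <;> have := h' x <;>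
    simp only [Multiset.count_add, Multiset.count_inter, Multiset.count_sub] <;> omega

variable {L : FirstOrder.Language.{u, v}} {C : ConstraintLanguage L} {Pred : ℕ → Type w}
  {R : Type z} {CT : L.Theory} {r₁ r₂ q₁ q₂ : Rule C Pred R} {S S₁ S₂ : State CT C Pred}
  {E₁ E₂ : Multiset (Atom L Pred)} {D₁ D₂ : Conj C} {X : Finset ℕ}

/-- Two presentations of a state by rule applications whose variables are apart, together with the
matching of their atoms: `m` matches head atoms with head atoms, `a` head atoms of the first rule
with other atoms, `b` other atoms with head atoms of the second rule, and `e` the remaining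
atoms. -/
structure Overlap (q₁ q₂ : Rule C Pred R) (E₁ E₂ : Multiset (Atom L Pred)) (D₁ D₂ : Conj C)
    (X : Finset ℕ) (m a b e : Multiset (AtomEq L Pred)) : Prop where
  heads_left : q₁.kept + q₁.removed = a.map AtomEq.lhs + m.map AtomEq.lhs
  rest_left : E₁ = b.map AtomEq.lhs + e.map AtomEq.lhs
  heads_right : q₂.kept + q₂.removed = b.map AtomEq.rhs + m.map AtomEq.rhs
  rest_right : E₂ = a.map AtomEq.rhs + e.map AtomEq.rhs
  disjoint_fv : ∀ x ∈ q₁.fv, x ∉ q₂.fv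
  lv_left : ∀ x ∈ q₁.lv, x ∉ q₂.fv ∪ atomsFv E₁ ∪ atomsFv E₂ ∪ D₁.fv ∪ D₂.fv ∪ X
  lv_right : ∀ x ∈ q₂.lv, x ∉ q₁.fv ∪ atomsFv E₁ ∪ atomsFv E₂ ∪ D₁.fv ∪ D₂.fv ∪ X

/-- The common built-in store of two overlapping rule applications. -/
def overlapConj (q₁ q₂ : Rule C Pred R) (D₁ D₂ : Conj C) (m a b e : Multiset (AtomEq L Pred)) :
    Conj C :=
  q₁.guard + q₂.guard + D₁ + D₂ + matchConj C m + matchConj C a + matchConj C b + matchConj C e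

theorem Rule.fv_source_subset (r : Rule C Pred R) (E : Multiset (Atom L Pred)) (D : Conj C) :
    atomsFv (r.kept + r.removed + E) ∪ (r.guard + D).fv ⊆ r.fv ∪ atomsFv E ∪ D.fv := by
  intro x hx
  have h1 := @Rule.fv_guard_subset _ _ _ _ r x
  have h2 := @Rule.atomsFv_heads_subset _ _ _ _ r x
  rw [atomsFv_add, Conj.fv_add] at hx
  simp only [Finset.mem_union] at hx ⊢
  tauto

theorem Rule.fv_target_subset (r : Rule C Pred R) (E : Multiset (Atom L Pred)) (D : Conj C) :
    atomsFv (r.kept + r.userBody + E) ∪ r.builtinBody.fv ⊆ r.fv ∪ atomsFv E ∪ D.fv := by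
  intro x hx
  have h1 := @Rule.fv_builtin_subset _ _ _ _ r x
  have h2 := @Rule.atomsFv_target_subset _ _ _ _ r x
  rw [Conj.fv_add] at h1
  rw [atomsFv_add] at hx
  simp only [Finset.mem_union] at h1 hx ⊢
  tauto

/-- The two presentations denote the same set, so their atoms are matched by equations. Splitting
each side into heads and rest cuts the matching into four blocks. As the presentations share only
global variables, the targets may absorb each other's stores and the equations. -/
theorem exists_overlap (h₁ : StepBy CT r₁ S S₁ q₁ E₁ D₁ X) (h₂ : StepBy CT r₂ S S₂ q₂ E₂ D₂ X)
    (hS : S ≠ failedState CT C Pred) (hX₁ : ∀ x ∈ q₁.fv, x ∉ X)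
    (hV : ∀ x ∈ q₁.fv ∪ atomsFv E₁ ∪ D₁.fv, x ∈ q₂.fv ∪ atomsFv E₂ ∪ D₂.fv → x ∈ X) :
    ∃ m a b e, Overlap q₁ q₂ E₁ E₂ D₁ D₂ X m a b e ∧
      (overlapConj q₁ q₂ D₁ D₂ m a b e).Satisfiable CT ∧
      S₁ = mkState CT (q₁.kept + q₁.userBody + E₁)
        (overlapConj q₁ q₂ D₁ D₂ m a b e + q₁.builtinBody) X ∧
      S₂ = mkState CT (q₂.kept + q₂.userBody + E₂)
        (overlapConj q₁ q₂ D₁ D₂ m a b e + q₂.builtinBody) X := by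
  have hE := h₁.source.symm.trans h₂.source
  have hD : (q₁.guard + D₁).Satisfiable CT := by
    by_contra hn
    exact hS (h₁.source.trans (mkState_eq_failedState hn))
  obtain ⟨l, hl⟩ := Quotient.exists_rep (q₁.kept + q₁.removed + E₁)
  obtain ⟨l', hl', hs⟩ := (semLE_of_mkState_eq hE).2 hD l hl
  obtain ⟨es, rfl, rfl⟩ := hs.exists_atomEqs hD
  dsimp only at hs hl'
  change (((es.map AtomEq.lhs : List _)) : Multiset (Atom L Pred)) = _ at hl
  set μ : Multiset (AtomEq L Pred) := (es : Multiset (AtomEq L Pred)) with hμ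
  have hlm : μ.map AtomEq.lhs = q₁.kept + q₁.removed + E₁ := hl
  have hrm : μ.map AtomEq.rhs = q₂.kept + q₂.removed + E₂ := hl'
  obtain ⟨α, β, hαβ, hα, hβ⟩ := Multiset.exists_of_map_eq_add _ hlm
  obtain ⟨γ, δ, hγδ, hγ, hδ⟩ := Multiset.exists_of_map_eq_add _ hrm
  obtain ⟨m, a, b, e, rfl, rfl, rfl, rfl⟩ := Multiset.exists_refinement (hαβ.symm.trans hγδ)
  have hVX : ∀ {V W V₁ V₂ : Finset ℕ}, V ⊆ V₁ → W ⊆ V₂ → (∀ x ∈ V₁, x ∈ V₂ → x ∈ X) →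
      ∀ x ∈ V ∪ X, x ∈ W → x ∈ X := fun h₁ h₂ h x hx hx' =>
    (Finset.mem_union.1 hx).elim (fun hx => h x (h₁ hx) (h₂ hx')) id
  have hV₁ := q₁.fv_source_subset E₁ D₁
  have hV₂ := q₂.fv_source_subset E₂ D₂
  rw [← hl] at hV₁
  rw [← hl'] at hV₂
  have hT₁ := q₁.fv_target_subset E₁ D₁
  have hT₂ := q₂.fv_target_subset E₂ D₂
  -- The user store plays no role here: `e₀` serves only to show that the common built-in store is
  -- satisfiable.
  have e₀ := mkState_absorb_of_sameDenotation hs μ (fun M val => holds_matchConj_coe.2) 0 0 X (by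
    refine hVX ?_ hV₂ hV
    simp only [Finset.union_subset_iff] at hV₁ ⊢
    exact ⟨⟨⟨Finset.empty_subset _, hV₁.2⟩, Finset.empty_subset _⟩, hV₁.1⟩)
  have e₁ := mkState_absorb_of_sameDenotation hs μ (fun M val => holds_matchConj_coe.2)
    (q₁.kept + q₁.userBody + E₁) q₁.builtinBody X (hVX (by
      simp only [Finset.union_subset_iff] at hV₁ hT₁ ⊢
      exact ⟨⟨⟨hT₁.1, hV₁.2⟩, hT₁.2⟩, hV₁.1⟩) hV₂ hV)
  have e₂ := mkState_absorb_of_sameDenotation hs.symm μ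
    (fun M val h => holds_matchConj_coe.2 h.symm)
    (q₂.kept + q₂.userBody + E₂) q₂.builtinBody X (hVX (by
      simp only [Finset.union_subset_iff] at hV₂ hT₂ ⊢
      exact ⟨⟨⟨hT₂.1, hV₂.2⟩, hT₂.2⟩, hV₂.1⟩) hV₁ fun x hx hx' => hV x hx' hx)
  have hμ' : matchConj C μ = matchConj C m + matchConj C a + matchConj C b + matchConj C e := by
    rw [hαβ]; simp only [matchConj_add]; abel
  rw [hμ'] at e₀ e₁ e₂
  refine ⟨m, a, b, e, ⟨?_, ?_, ?_, ?_, ?_, ?_, ?_⟩, ?_, ?_, ?_⟩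
  · rw [← hα, Multiset.map_add, add_comm]
  · rw [← hβ, Multiset.map_add]
  · rw [← hγ, Multiset.map_add, add_comm]
  · rw [← hδ, Multiset.map_add]
  · intro x hx hx'
    have := hV x
    simp only [Finset.mem_union] at this
    exact hX₁ x hx (this (Or.inl (Or.inl hx)) (Or.inl (Or.inl hx')))
  · intro x hx hx'
    have h3 := hV x
    have h4 := h₁.apart x hx
    have h5 := q₁.lv_subset hx
    simp only [Finset.mem_union] at h3 h4 hx'
    clear * - h3 h4 h5 hx'
    tauto
  · intro x hx hx'
    have h3 := hV x
    have h4 := h₂.apart x hx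
    have h5 := q₂.lv_subset hx
    simp only [Finset.mem_union] at h3 h4 hx'
    clear * - h3 h4 h5 hx'
    tauto
  · have := (satisfiable_iff_of_mkState_eq e₀).1 (by simpa using hD)
    convert this using 1
    simp only [overlapConj]; abel
  · rw [h₁.target]
    convert e₁ using 2
    · abel
    · simp only [overlapConj]; abel
  · rw [h₂.target]
    convert e₂ using 2
    · abel
    · simp only [overlapConj]; abel

variable {m a b e : Multiset (AtomEq L Pred)}

/-- All atoms matched between the two heads are kept by both rules, so neither step consumes what
the other needs. The equations turn the remaining atoms into the heads of the other rule. -/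
theorem Overlap.commute (h : Overlap q₁ q₂ E₁ E₂ D₁ D₂ X m a b e) {P Q : Set (Rule C Pred R)}
    (hr₁ : r₁ ∈ P) (hr₂ : r₂ ∈ Q) (hq₁ : ∃ ρ : Equiv.Perm ℕ, q₁ = r₁.rename ρ)
    (hq₂ : ∃ ρ : Equiv.Perm ℕ, q₂ = r₂.rename ρ) (hk₁ : m.map AtomEq.lhs ≤ q₁.kept)
    (hk₂ : m.map AtomEq.rhs ≤ q₂.kept) :
    ∃ T, Step CT Q (mkState CT (q₁.kept + q₁.userBody + E₁)
        (overlapConj q₁ q₂ D₁ D₂ m a b e + q₁.builtinBody) X) T ∧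
      Step CT P (mkState CT (q₂.kept + q₂.userBody + E₂)
        (overlapConj q₁ q₂ D₁ D₂ m a b e + q₂.builtinBody) X) T := by
  obtain ⟨k₁, hk₁⟩ := Multiset.le_iff_exists_add.1 hk₁
  obtain ⟨k₂, hk₂⟩ := Multiset.le_iff_exists_add.1 hk₂
  have ha : a.map AtomEq.lhs = k₁ + q₁.removed := by
    have := h.heads_left
    rw [hk₁, add_comm (a.map _), add_assoc] at this
    exact (add_left_cancel this).symm
  have hb : b.map AtomEq.rhs = k₂ + q₂.removed := by
    have := h.heads_right
    rw [hk₂, add_comm (b.map _), add_assoc] at this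
    exact (add_left_cancel this).symm
  have hE₁ := h.rest_left
  have hE₂ := h.rest_right
  have hfv₁ : ∀ x, x ∈ atomsFv k₁ → x ∈ q₁.fv := fun x hx => q₁.atomsFv_heads_subset (by
    rw [hk₁]; simp only [atomsFv_add, Finset.mem_union]; tauto)
  have hfv₂ : ∀ x, x ∈ atomsFv k₂ → x ∈ q₂.fv := fun x hx => q₂.atomsFv_heads_subset (by
    rw [hk₂]; simp only [atomsFv_add, Finset.mem_union]; tauto)
  have hB₁ : ∀ x, x ∈ atomsFv q₁.userBody ∪ (q₁.guard + q₁.builtinBody).fv → x ∈ q₁.fv :=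
    fun x hx => by
      rw [Rule.mem_fv]
      simp only [atomsFv_add, Finset.mem_union] at hx ⊢; tauto
  have hB₂ : ∀ x, x ∈ atomsFv q₂.userBody ∪ (q₂.guard + q₂.builtinBody).fv → x ∈ q₂.fv :=
    fun x hx => by
      rw [Rule.mem_fv]
      simp only [atomsFv_add, Finset.mem_union] at hx ⊢; tauto
  have he : ∀ x, x ∈ atomsFv (e.map AtomEq.lhs) → x ∈ atomsFv E₁ := fun x hx => by
    rw [hE₁, atomsFv_add]; exact Finset.mem_union_right _ hx
  have hM : ∀ x, x ∈ (matchConj C (m + a + b + e)).fv →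
      x ∈ q₁.headFv ∪ q₂.headFv ∪ atomsFv E₁ ∪ atomsFv E₂ := fun x hx => by
    rw [Rule.headFv, Rule.headFv, h.heads_left, h.heads_right, hE₁, hE₂]
    simp only [fv_matchConj, Multiset.map_add, atomsFv_add, Finset.mem_union] at hx ⊢
    tauto
  have hH₁ := q₁.headFv_subset
  have hH₂ := q₂.headFv_subset
  have hM' : matchConj C (m + a + b + e) =
      matchConj C m + matchConj C a + matchConj C b + matchConj C e := by
    simp only [matchConj_add]
  -- The common reduct holds one copy of the shared kept atoms, the unshared kept atoms `k₁` and
  -- `k₂`, both bodies and the untouched atoms.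
  refine ⟨mkState CT (q₂.kept + q₂.userBody + (k₁ + q₁.userBody + e.map AtomEq.lhs))
    (q₂.guard + q₂.builtinBody + (q₁.guard + D₁ + D₂ + matchConj C (m + a + b + e) +
      q₁.builtinBody)) X, step_iff.2 ⟨r₂, hr₂, q₂, _, _, X, hq₂, ?_, ?_, rfl⟩,
    step_iff.2 ⟨r₁, hr₁, q₁, k₂ + q₂.userBody + e.map AtomEq.lhs,
      q₂.guard + D₁ + D₂ + matchConj C (m + a + b + e) + q₂.builtinBody, X, hq₁, ?_, ?_, ?_⟩⟩
  · intro x hx hx'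
    have h1 := h.lv_right x hx
    have h2 := (Finset.mem_sdiff.1 hx).2
    have h3 := hfv₁ x; have h4 := hB₁ x; have h5 := he x; have h6 := hM x; have h7 := @hH₁ x
    simp only [atomsFv_add, Conj.fv_add, Finset.mem_union] at hx' h1 h2 h4 h6
    grind
  · refine (mkState_rewrite (m := m + b) X (k₁ + q₁.userBody + e.map AtomEq.lhs) ?_ rfl
      (Multiset.le_iff_exists_add.2 ⟨q₁.guard + q₂.guard + D₁ + D₂ + matchConj C a +
        matchConj C e + q₁.builtinBody, ?_⟩)).trans ?_
    · rw [hk₁, hE₁, Multiset.map_add]; abel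
    · simp only [overlapConj, matchConj_add]; abel
    · congr 1
      · rw [Multiset.map_add, hb, hk₂]; abel
      · rw [hM', overlapConj]; abel
  · intro x hx hx'
    have h1 := h.lv_left x hx
    have h2 := (Finset.mem_sdiff.1 hx).2
    have h3 := hfv₂ x; have h4 := hB₂ x; have h5 := he x; have h6 := hM x; have h7 := @hH₂ x
    simp only [atomsFv_add, Conj.fv_add, Finset.mem_union] at hx' h1 h2 h4 h6
    grind
  · refine (mkState_rewrite (m := m + a + e) X (k₂ + q₂.userBody) rfl ?_
      (Multiset.le_iff_exists_add.2 ⟨q₁.guard + q₂.guard + D₁ + D₂ + matchConj C b +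
        q₂.builtinBody, ?_⟩)).symm.trans ?_
    · rw [hk₂, hE₂]; simp only [Multiset.map_add]; abel
    · simp only [overlapConj, matchConj_add]; abel
    · congr 1
      · simp only [Multiset.map_add]; rw [ha, hk₁]; abel
      · rw [hM', overlapConj]; abel
  · refine (mkState_rewrite (m := m) X (k₁ + k₂ + q₁.userBody + q₂.userBody + e.map AtomEq.lhs)
      (A := q₁.kept + q₁.userBody + (k₂ + q₂.userBody + e.map AtomEq.lhs)) ?_ ?_
      (Multiset.le_iff_exists_add.2 ⟨q₁.guard + q₂.guard + D₁ + D₂ + matchConj C a + matchConj C b +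
        matchConj C e + q₁.builtinBody + q₂.builtinBody, ?_⟩)).symm.trans ?_
    · rw [hk₁]; abel
    · rw [hk₂]; abel
    · simp only [matchConj_add]; abel
    · congr 1
      abel

/-- The head atoms outside the overlap are `a` on the left and `b` on the right, and the rest of the
state forms the context: the atoms of `e`, the stores `D₁` and `D₂`, and the equations of `a`, `b`
and `e`. The map `f` preserves steps for every set of rules, hence for every label. -/
theorem Overlap.critical (h : Overlap q₁ q₂ E₁ E₂ D₁ D₂ X m a b e) {P Q : Set (Rule C Pred R)}
    (hr₁ : r₁ ∈ P) (hr₂ : r₂ ∈ Q) (hq₁ : ∃ ρ : Equiv.Perm ℕ, q₁ = r₁.rename ρ)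
    (hq₂ : ∃ ρ : Equiv.Perm ℕ, q₂ = r₂.rename ρ)
    (hk : ¬ m.map AtomEq.lhs ≤ q₁.kept ∨ ¬ m.map AtomEq.rhs ≤ q₂.kept)
    (hsat : (overlapConj q₁ q₂ D₁ D₂ m a b e).Satisfiable CT) :
    ∃ f : State CT C Pred → State CT C Pred,
      (∀ (P : Set (Rule C Pred R)) S T, Step CT P S T → Step CT P (f S) (f T)) ∧
      ∃ Sl Sc Sr, IsCriticalPeak CT P Q r₁.name r₂.name Sl Sc Sr ∧
        f Sl = mkState CT (q₁.kept + q₁.userBody + E₁)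
          (overlapConj q₁ q₂ D₁ D₂ m a b e + q₁.builtinBody) X ∧
        f Sr = mkState CT (q₂.kept + q₂.userBody + E₂)
          (overlapConj q₁ q₂ D₁ D₂ m a b e + q₂.builtinBody) X := by
  obtain ⟨ρ₁, hρ₁⟩ := hq₁
  obtain ⟨ρ₂, hρ₂⟩ := hq₂
  obtain ⟨f, hf, hstep⟩ := exists_extend_step (CT := CT) (R := R) (e.map AtomEq.lhs)
    (D₁ + D₂ + matchConj C a + matchConj C b + matchConj C e) X
  have hE₁ := h.rest_left
  have hE₂ := h.rest_right
  have hm : m ≠ 0 := by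
    rintro rfl
    simp at hk
  -- Local rule variables do not occur in the context, so whatever the rules share with it is a head
  -- variable, and these are global in the critical peak.
  have hctx : ∀ x ∈ q₁.fv ∪ q₂.fv, x ∈ atomsFv (e.map AtomEq.lhs) ∪
      (D₁ + D₂ + matchConj C a + matchConj C b + matchConj C e).fv ∪ X →
        x ∈ q₁.headFv ∪ q₂.headFv := by
    intro x hx hx'
    by_contra hn
    have h1 := h.lv_left x
    have h2 := h.lv_right x
    have h3 := @Rule.headFv_subset _ _ _ _ q₁ x
    have h4 := @Rule.headFv_subset _ _ _ _ q₂ x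
    rw [hE₁, hE₂] at h1 h2
    rw [Rule.lv, Finset.mem_sdiff] at h1 h2
    have h5 := h.heads_left
    have h6 := h.heads_right
    rw [Rule.headFv, h5] at hn h1 h3
    rw [Rule.headFv, h6] at hn h2 h4
    simp only [Conj.fv_add, atomsFv_add, fv_matchConj, Finset.mem_union] at hx hx' hn h1 h2
    grind
  have hA₁ := q₁.atomsFv_target_subset
  have hA₂ := q₂.atomsFv_target_subset
  have hH₁ := q₁.atomsFv_heads_subset
  have hH₂ := q₂.atomsFv_heads_subset
  have hC₁ := q₁.fv_builtin_subset
  have hC₂ := q₂.fv_builtin_subset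
  rw [h.heads_left] at hH₁
  rw [h.heads_right] at hH₂
  refine ⟨f, hstep, _, _, _, ⟨r₁, hr₁, r₂, hr₂, ρ₁, ρ₂, q₁, q₂, a.map AtomEq.lhs,
    b.map AtomEq.rhs, m, _, _, rfl, rfl, hρ₁, hρ₂, Finset.disjoint_left.2 fun x => h.disjoint_fv x,
    hm, h.heads_left, h.heads_right, rfl, rfl, hsat.mono ?_, hk, rfl, rfl, rfl⟩, ?_, ?_⟩
  · refine Multiset.le_iff_exists_add.2 ⟨D₁ + D₂ + matchConj C a + matchConj C b + matchConj C e,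
      ?_⟩
    rw [overlapConj]; abel
  · rw [hf]
    -- The critical peak contains the atoms of `b` as they occur in the second head; the equations
    -- turn them back into atoms of `E₁`.
    · refine (mkState_rewrite (m := b) X (q₁.kept + q₁.userBody + e.map AtomEq.lhs)
        (A := q₁.kept + q₁.userBody + E₁) ?_ ?_ (Multiset.le_iff_exists_add.2 ⟨q₁.guard + q₂.guard + D₁ + D₂ + matchConj C m +
          matchConj C a + matchConj C e + q₁.builtinBody, ?_⟩)).symm.trans ?_
      · rw [hE₁]; abel
      · abel
      · abel
      · congr 1
        rw [overlapConj]; abel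
    · intro x hx
      refine hctx x ?_
      have h1 := @hA₁ x; have h2 := @hA₂ x; have h3 := @hH₁ x; have h4 := @hH₂ x
      have h5 := @hC₁ x; have h6 := @hC₂ x
      simp only [Conj.fv_add, atomsFv_add, fv_matchConj, Finset.mem_union] at hx h1 h2 h3 h4 h5 h6 ⊢
      grind
  · rw [hf]
    · refine (mkState_rewrite (m := a + e) X (q₂.kept + q₂.userBody)
        (A' := q₂.kept + q₂.userBody + E₂) ?_ ?_ (Multiset.le_iff_exists_add.2 ⟨q₁.guard + q₂.guard + D₁ + D₂ + matchConj C m +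
          matchConj C b + q₂.builtinBody, ?_⟩)).trans ?_
      · rw [Multiset.map_add]; abel
      · rw [hE₂, Multiset.map_add]
      · simp only [matchConj_add]; abel
      · congr 1
        rw [overlapConj]; abel
    · intro x hx
      refine hctx x ?_
      have h1 := @hA₁ x; have h2 := @hA₂ x; have h3 := @hH₁ x; have h4 := @hH₂ x
      have h5 := @hC₁ x; have h6 := @hC₂ x
      simp only [Conj.fv_add, atomsFv_add, fv_matchConj, Finset.mem_union] at hx h1 h2 h3 h4 h5 h6 ⊢
      grind

/-- A peak from a consistent state either commutes or is an instance of a critical peak. -/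
theorem peak_cases {P Q : Set (Rule C Pred R)} (hr₁ : r₁ ∈ P) (hr₂ : r₂ ∈ Q)
    (h₁ : Step CT {r₁} S S₁) (h₂ : Step CT {r₂} S S₂) (hS : S ≠ failedState CT C Pred) :
    (∃ T, Step CT {r₂} S₁ T ∧ Step CT {r₁} S₂ T) ∨
    ∃ f : State CT C Pred → State CT C Pred,
      (∀ (P : Set (Rule C Pred R)) S T, Step CT P S T → Step CT P (f S) (f T)) ∧
      ∃ Sl Sc Sr, IsCriticalPeak CT P Q r₁.name r₂.name Sl Sc Sr ∧ f Sl = S₁ ∧ f Sr = S₂ := by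
  obtain ⟨_, rfl, p₁, F₁, B₁, X₁, hs₁⟩ := step_iff.1 h₁
  obtain ⟨_, rfl, p₂, F₂, B₂, X₂, hs₂⟩ := step_iff.1 h₂
  -- Both steps are presented over the global variables `X₁ ∪ X₂`, the second one apart from
  -- everything in the first.
  obtain ⟨q₁, E₁, D₁, k₁, hX₁, -⟩ := hs₁.exists_fresh (Finset.subset_union_left (s₂ := X₂)) ∅
  obtain ⟨q₂, E₂, D₂, k₂, -, hV⟩ := hs₂.exists_fresh (Finset.subset_union_right (s₁ := X₁))
    (q₁.fv ∪ atomsFv E₁ ∪ D₁.fv)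
  obtain ⟨m, a, b, e, ho, hsat, rfl, rfl⟩ :=
    exists_overlap k₁ k₂ hS hX₁ fun x hx hx' => hV x hx' hx
  by_cases hk : m.map AtomEq.lhs ≤ q₁.kept ∧ m.map AtomEq.rhs ≤ q₂.kept
  · exact Or.inl (ho.commute (Set.mem_singleton _) (Set.mem_singleton _) k₁.isRenaming
      k₂.isRenaming hk.1 hk.2)
  · exact Or.inr (ho.critical hr₁ hr₂ k₁.isRenaming k₂.isRenaming (not_and_or.1 hk) hsat)

end Peaks

end CHR

namespace CHR

/-! ### The labeling of transitions and the confluence of rule-decreasing programs -/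

section Confluence

variable {L : FirstOrder.Language.{u, v}} {C : ConstraintLanguage L} {Pred : ℕ → Type w}
  {R : Type z} {CT : L.Theory} {S T : State CT C Pred}

theorem eq_failedState_of_step {P : Set (Rule C Pred R)} (h : Step CT P S T)
    (hS : S = failedState CT C Pred) : T = failedState CT C Pred := by
  obtain ⟨r₀, -, r, E, D, X, h⟩ := step_iff.1 h
  rw [h.source, mkState_eq_failedState_iff] at hS
  rw [h.target, mkState_eq_failedState_iff]
  refine fun h' => hS (h'.mono ?_)
  rw [add_right_comm]
  exact Multiset.le_add_right _ _

theorem step_mono {P Q : Set (Rule C Pred R)} (hPQ : P ⊆ Q) (h : Step CT P S T) : Step CT Q S T :=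
  let ⟨r, hr, h⟩ := h
  ⟨r, hPQ hr, h⟩

theorem exists_singleton_step {P : Set (Rule C Pred R)} (h : Step CT P S T) :
    ∃ r ∈ P, Step CT {r} S T :=
  let ⟨r, hr, h⟩ := h
  ⟨r, hr, r, Set.mem_singleton r, h⟩

theorem singleton_step_mono {P : Set (Rule C Pred R)} {r : Rule C Pred R} (hr : r ∈ P)
    (h : Step CT {r} S T) : Step CT P S T := step_mono (Set.singleton_subset_iff.2 hr) h

/-- The converse of the transition relation of `P` on consistent states. -/
def StepBack (CT : L.Theory) (P : Set (Rule C Pred R)) (T S : State CT C Pred) : Prop :=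
  S ≠ failedState CT C Pred ∧ Step CT P S T

theorem Terminating.isWellFounded {P : Set (Rule C Pred R)} (h : Terminating CT P) :
    IsWellFounded (State CT C Pred) (StepBack CT P) :=
  ⟨wellFounded_iff_isEmpty_descending_chain.2 ⟨fun f => h ⟨f.1, f.2⟩⟩⟩

variable (CT) in
-- Transports the decreasing diagram of a critical peak to its instances, since a context preserves
-- every label.
theorem DecreasingSide.map [Preorder R] {P : Program C Pred R}
    {f : State CT C Pred → State CT C Pred}
    (hf : ∀ (Q : Set (Rule C Pred R)) S T, Step CT Q S T → Step CT Q (f S) (f T)) {a b : R}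
    (h : DecreasingSide (P.labelStep CT) a b S T) :
    DecreasingSide (P.labelStep CT) a b (f S) (f T) := by
  have hf' : ∀ (K : Set R) (S T : State CT C Pred), unionOver (P.labelStep CT) K S T →
      unionOver (P.labelStep CT) K (f S) (f T) :=
    fun K S T ⟨i, hi, h⟩ => ⟨i, hi, hf _ _ _ h⟩
  obtain ⟨x₁, x₂, h₁, h₂, h₃⟩ := h
  refine ⟨f x₁, f x₂, h₁.lift f (hf' _), ?_, h₃.lift f (hf' _)⟩
  cases h₂ with
  | refl => exact .refl
  | single h => exact .single (hf' _ _ _ h)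

/-- The number of names of rules of `P` that are smaller than `n`. -/
noncomputable def nameRank [Preorder R] (P : Program C Pred R) (n : R) : ℕ :=
  {m ∈ Rule.name '' P.rules | m < n}.ncard

theorem nameRank_le [Preorder R] (P : Program C Pred R) {m n : R} (h : m ≤ n) :
    nameRank P m ≤ nameRank P n :=
  Set.ncard_le_ncard (fun _ hk => ⟨hk.1, hk.2.trans_le h⟩)
    ((P.finite.image _).subset (Set.sep_subset _ _))

/-- The name of `r` itself is counted below `n` but not below itself. The rank replaces an arbitrary
preorder, possibly neither total nor well-founded, by natural numbers. -/
theorem nameRank_lt [Preorder R] (P : Program C Pred R) {r : Rule C Pred R} (hr : r ∈ P.rules)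
    {n : R} (h : r.name < n) : nameRank P r.name < nameRank P n :=
  Set.ncard_lt_ncard ⟨fun _ hk => ⟨hk.1, hk.2.trans h⟩,
    fun hs => lt_irrefl _ (hs ⟨Set.mem_image_of_mem _ hr, h⟩).2⟩
    ((P.finite.image _).subset (Set.sep_subset _ _))

variable [pre : Preorder R] {P : Program C Pred R} {Ri : Set R}
  [hwf : IsWellFounded (State CT C Pred) (StepBack CT (P.inductivePart Ri))]

open Classical in
/-- Transitions with inductive rules are labeled with the rank of their source, those with
coinductive rules with the rank of the rule. -/
noncomputable def stepLabel (CT : L.Theory) (P : Program C Pred R) (Ri : Set R)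
    [IsWellFounded (State CT C Pred) (StepBack CT (P.inductivePart Ri))]
    (r : Rule C Pred R) (S : State CT C Pred) : ℕ ×ₗ Ordinal :=
  if r.name ∈ Ri then toLex (0, IsWellFounded.rank (StepBack CT (P.inductivePart Ri)) S)
  else toLex (nameRank P r.name + 1, 0)

/-- The transitions from consistent states, labeled with `stepLabel`. -/
def rankStep (CT : L.Theory) (P : Program C Pred R) (Ri : Set R)
    [IsWellFounded (State CT C Pred) (StepBack CT (P.inductivePart Ri))]
    (l : ℕ ×ₗ Ordinal) (S T : State CT C Pred) : Prop :=
  S ≠ failedState CT C Pred ∧ ∃ r ∈ P.rules, Step CT {r} S T ∧ l = stepLabel CT P Ri r S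

theorem stepLabel_inductive {r : Rule C Pred R} (h : r.name ∈ Ri) (S : State CT C Pred) :
    stepLabel CT P Ri r S =
      toLex (0, IsWellFounded.rank (StepBack CT (P.inductivePart Ri)) S) := if_pos h

theorem stepLabel_coinductive {r : Rule C Pred R} (h : r.name ∉ Ri) (S : State CT C Pred) :
    stepLabel CT P Ri r S = toLex (nameRank P r.name + 1, 0) := if_neg h

theorem stepLabel_lt_of_inductive {r : Rule C Pred R} (h : r.name ∈ Ri) (S : State CT C Pred)
    (n : ℕ) (o : Ordinal) : stepLabel CT P Ri r S < toLex (n + 1, o) := by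
  rw [stepLabel_inductive h, Prod.Lex.toLex_lt_toLex]
  exact Or.inl n.succ_pos

theorem stepLabel_lt_of_step {r r' : Rule C Pred R} (hr : r ∈ P.rules) (h : r.name ∈ Ri)
    (h' : r'.name ∈ Ri) (hS : S ≠ failedState CT C Pred) (hST : Step CT {r} S T) :
    stepLabel CT P Ri r' T < stepLabel CT P Ri r S := by
  rw [stepLabel_inductive h, stepLabel_inductive h', Prod.Lex.toLex_lt_toLex]
  exact Or.inr ⟨rfl, IsWellFounded.rank_lt_of_rel
    (r := StepBack CT (P.inductivePart Ri)) ⟨hS, singleton_step_mono ⟨hr, h⟩ hST⟩⟩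

theorem stepLabel_lt_of_name_lt {r r' : Rule C Pred R} (hr : r ∈ P.rules) (h' : r'.name ∉ Ri)
    (h : r.name < r'.name) (S T : State CT C Pred) :
    stepLabel CT P Ri r S < stepLabel CT P Ri r' T := by
  rw [stepLabel_coinductive h']
  by_cases hi : r.name ∈ Ri
  · exact stepLabel_lt_of_inductive hi _ _ _
  · rw [stepLabel_coinductive hi, Prod.Lex.toLex_lt_toLex]
    exact Or.inl (Nat.succ_lt_succ (nameRank_lt P hr h))

theorem stepLabel_le_of_name_le {r r' : Rule C Pred R} (h' : r'.name ∉ Ri)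
    (h : r.name ≤ r'.name) (S T : State CT C Pred) :
    stepLabel CT P Ri r S ≤ stepLabel CT P Ri r' T := by
  rw [stepLabel_coinductive h']
  by_cases hi : r.name ∈ Ri
  · exact (stepLabel_lt_of_inductive hi _ _ _).le
  · rw [stepLabel_coinductive hi, Prod.Lex.toLex_le_toLex]
    rcases (nameRank_le P h).lt_or_eq with h | h
    · exact Or.inl (Nat.succ_lt_succ h)
    · exact Or.inr ⟨congrArg Nat.succ h, le_rfl⟩

/-- A single transition gives rise to a path of length at most one. -/
theorem exists_path_of_step {r : Rule C Pred R} (hr : r ∈ P.rules) (h : Step CT {r} S T) :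
    ∃ s, (∀ l ∈ s, l = stepLabel CT P Ri r S) ∧ s.length ≤ 1 ∧ Path (rankStep CT P Ri) s S T := by
  by_cases hS : S = failedState CT C Pred
  · rw [eq_failedState_of_step h hS, hS]
    exact ⟨[], by simp, by simp, .nil _⟩
  · exact ⟨[stepLabel CT P Ri r S], by simp, by simp, .cons ⟨hS, r, hr, h, rfl⟩ (.nil _)⟩

theorem exists_path_of_labelStep {Q : ℕ ×ₗ Ordinal → Prop} {K : Set R}
    (hQ : ∀ r ∈ P.rules, r.name ∈ K → ∀ S : State CT C Pred, Q (stepLabel CT P Ri r S))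
    (h : unionOver (P.labelStep CT) K S T) :
    ∃ s, (∀ l ∈ s, Q l) ∧ s.length ≤ 1 ∧ Path (rankStep CT P Ri) s S T := by
  obtain ⟨n, hn, h⟩ := h
  obtain ⟨r, ⟨hr, rfl⟩, h'⟩ := exists_singleton_step h
  obtain ⟨s, hs, hl, p⟩ := exists_path_of_step (Ri := Ri) hr h'
  exact ⟨s, fun l hl => hs l hl ▸ hQ r hr hn S, hl, p⟩

theorem exists_path_of_reflGen {Q : ℕ ×ₗ Ordinal → Prop} {K : Set R}
    (hQ : ∀ r ∈ P.rules, r.name ∈ K → ∀ S : State CT C Pred, Q (stepLabel CT P Ri r S))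
    (h : Relation.ReflGen (unionOver (P.labelStep CT) K) S T) :
    ∃ s, (∀ l ∈ s, Q l) ∧ s.length ≤ 1 ∧ Path (rankStep CT P Ri) s S T := by
  cases h with
  | refl => exact ⟨[], by simp, by simp, .nil _⟩
  | single h => exact exists_path_of_labelStep hQ h

theorem exists_path_of_reflTransGen {Q : ℕ ×ₗ Ordinal → Prop} {K : Set R}
    (hQ : ∀ r ∈ P.rules, r.name ∈ K → ∀ S : State CT C Pred, Q (stepLabel CT P Ri r S))
    (h : Relation.ReflTransGen (unionOver (P.labelStep CT) K) S T) :
    ∃ s, (∀ l ∈ s, Q l) ∧ Path (rankStep CT P Ri) s S T := by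
  induction h using Relation.ReflTransGen.head_induction_on with
  | refl => exact ⟨[], by simp, .nil _⟩
  | head h _ ih =>
    obtain ⟨s, hs, -, p⟩ := exists_path_of_labelStep hQ h
    obtain ⟨t, ht, q⟩ := ih
    exact ⟨s ++ t, fun l hl => (List.mem_append.1 hl).elim (hs l) (ht l), p.append q⟩

/-- Ranks decrease along inductive transitions, so a bound on the labels at the start holds along
the whole path. -/
theorem exists_path_of_inductive {b : ℕ ×ₗ Ordinal}
    (h : Relation.ReflTransGen (Step CT (P.inductivePart Ri)) S T)
    (hb : ∀ r : Rule C Pred R, r.name ∈ Ri → stepLabel CT P Ri r S < b) :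
    ∃ s, (∀ l ∈ s, l < b) ∧ Path (rankStep CT P Ri) s S T := by
  induction h using Relation.ReflTransGen.head_induction_on with
  | refl => exact ⟨[], by simp, .nil _⟩
  | @head S S' h h' ih =>
    -- From the failed state only the failed state is reachable, so the empty path suffices.
    by_cases hS : S = failedState CT C Pred
    · have hT : T = failedState CT C Pred := by
        have := eq_failedState_of_step h hS
        clear * - this h'
        induction h' with
        | refl => exact this
        | tail _ h ih => exact eq_failedState_of_step h ih
      rw [hS, hT]
      exact ⟨[], by simp, .nil _⟩
    · obtain ⟨r, hr, hst⟩ := exists_singleton_step h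
      obtain ⟨s, hs, p⟩ := ih fun r' hr' =>
        (stepLabel_lt_of_step hr.1 hr.2 hr' hS hst).trans (hb r hr.2)
      exact ⟨_ :: s, List.forall_mem_cons.2 ⟨hb r hr.2, hs⟩, .cons ⟨hS, r, hr.1, hst, rfl⟩ p⟩

/-- The paths of a decreasing side with their labels. -/
theorem DecreasingSide.exists_closes {r₁ r₂ : Rule C Pred R} {a b : ℕ ×ₗ Ordinal}
    (h : DecreasingSide (P.labelStep CT) r₁.name r₂.name S T)
    (h₁ : ∀ T', Relation.ReflTransGen (unionOver (P.labelStep CT) (strictlyBelow {r₁.name})) S T' →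
      ∃ s, (∀ l ∈ s, l < a) ∧ Path (rankStep CT P Ri) s S T')
    (h₂ : ∀ r ∈ P.rules, r.name ≤ r₂.name → ∀ S : State CT C Pred,
      stepLabel CT P Ri r S < a ∨ stepLabel CT P Ri r S ≤ b)
    (h₃ : ∀ r ∈ P.rules, r.name < r₁.name ∨ r.name < r₂.name → ∀ S : State CT C Pred,
      stepLabel CT P Ri r S < a ∨ stepLabel CT P Ri r S < b) :
    ∃ t, Path (rankStep CT P Ri) t S T ∧ Closes [a] [b] t := by
  obtain ⟨x₁, x₂, k₁, k₂, k₃⟩ := h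
  obtain ⟨s₁, hs₁, p₁⟩ := h₁ _ k₁
  obtain ⟨s₂, hs₂, hl, p₂⟩ := exists_path_of_reflGen (Ri := Ri) (Q := fun l => l < a ∨ l ≤ b)
    (fun r hr hrK S => h₂ r hr (by
      obtain ⟨k, hk, hrk⟩ := hrK
      rwa [← Set.mem_singleton_iff.1 hk]) S) k₂
  obtain ⟨s₃, hs₃, p₃⟩ := exists_path_of_reflTransGen (Ri := Ri) (Q := fun l => l < a ∨ l < b)
    (fun r hr hrK S => h₃ r hr (by
      obtain ⟨k, hk, hrk⟩ := hrK
      rcases hk with rfl | rfl <;> simp [hrk]) S) k₃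
  refine ⟨s₁ ++ (s₂ ++ s₃), p₁.append (p₂.append p₃), ?_⟩
  match s₂, hs₂, hl with
  | [], _, _ => exact closes_of_shape (s₂ := []) hs₁ (by simp) (by simp) hs₃
  | [e], hs₂, _ =>
    -- A middle step below `a` is moved to the first block. This occurs when its rule is inductive:
    -- its rank need not be bounded by `b`, but lies below the coinductive label `a`.
    rcases hs₂ e (by simp) with he | he
    · have := closes_of_shape (s₁ := s₁ ++ [e]) (s₂ := []) (s₃ := s₃) (a := a) (b := b)
        (fun l hl => (List.mem_append.1 hl).elim (hs₁ l) fun h => by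
          rwa [List.mem_singleton.1 h]) (by simp) (by simp) hs₃
      simpa using this
    · exact closes_of_shape hs₁ (by simpa using he) (by simp) hs₃

theorem name_mem_of_le (hpre : Admissible Ri pre) {m n : R} (h : m ≤ n) (hn : n ∈ Ri) : m ∈ Ri := by
  by_contra hm
  exact lt_irrefl _ (h.trans_lt (hpre n hn m hm))

/-- If both rules are coinductive, the order of names carries over to labels. If `r₂` is inductive,
every name below it is inductive too, and such steps lie below the label of `r₁` from whatever state
they start. -/
theorem exists_closes_of_coinductive_peak (hpre : Admissible Ri pre) {r₁ r₂ : Rule C Pred R}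
    {S₁ S₂ : State CT C Pred} (hr₂ : r₂ ∈ P.rules) (hi₁ : r₁.name ∉ Ri)
    (hS : S ≠ failedState CT C Pred) (hS₂ : Step CT {r₂} S S₂)
    (h : DecreasingPeak (P.labelStep CT) r₁.name r₂.name S₁ S₂) :
    ∃ e s t, Path (rankStep CT P Ri) t S₁ e ∧ Path (rankStep CT P Ri) s S₂ e ∧
      Closes [stepLabel CT P Ri r₁ S] [stepLabel CT P Ri r₂ S] t ∧
      Closes [stepLabel CT P Ri r₂ S] [stepLabel CT P Ri r₁ S] s := by
  obtain ⟨e, h₁, h₂⟩ := h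
  have below : ∀ {r' : Rule C Pred R}, r'.name ∉ Ri → ∀ {T T' : State CT C Pred},
      Relation.ReflTransGen (unionOver (P.labelStep CT) (strictlyBelow {r'.name})) T T' →
        ∃ s, (∀ l ∈ s, l < stepLabel CT P Ri r' S) ∧ Path (rankStep CT P Ri) s T T' :=
    fun {r'} hr' {T T'} hT => exists_path_of_reflTransGen (fun r hr hrK _ =>
      stepLabel_lt_of_name_lt hr hr' (by
        obtain ⟨k, hk, hrk⟩ := hrK
        rwa [← Set.mem_singleton_iff.1 hk]) _ _) hT
  have lt_of_mem : ∀ r : Rule C Pred R, r.name ∈ Ri → ∀ T : State CT C Pred,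
      stepLabel CT P Ri r T < stepLabel CT P Ri r₁ S := fun r hr T => by
    rw [stepLabel_coinductive hi₁]; exact stepLabel_lt_of_inductive hr _ _ _
  by_cases hi₂ : r₂.name ∈ Ri
  · obtain ⟨t, pt, ct⟩ := h₁.exists_closes (a := stepLabel CT P Ri r₁ S)
      (b := stepLabel CT P Ri r₂ S) (fun T' => below hi₁)
      (fun r _ hrn T => Or.inl (lt_of_mem r (name_mem_of_le hpre hrn hi₂) T))
      (fun r hr hrn T => Or.inl (hrn.elim (fun h => stepLabel_lt_of_name_lt hr hi₁ h _ _)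
        fun h => lt_of_mem r (name_mem_of_le hpre h.le hi₂) T))
    -- The first block on this side must stay below the label of `r₂` at `S`. It consists of
    -- inductive steps from `S₂`, whose rank is smaller than that of `S`.
    obtain ⟨s, ps, cs⟩ := h₂.exists_closes (a := stepLabel CT P Ri r₂ S)
      (b := stepLabel CT P Ri r₁ S) (fun T' hT => exists_path_of_inductive
        (Relation.ReflTransGen.mono (fun x y ⟨n, ⟨k, hk, hnk⟩, hxy⟩ => step_mono (fun r hr => ⟨hr.1, by
          rw [Set.mem_singleton_iff.1 hk] at hnk
          exact name_mem_of_le hpre (hr.2.trans_lt hnk).le hi₂⟩) hxy) _ _ hT)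
        fun r hr => stepLabel_lt_of_step hr₂ hi₂ hr hS hS₂)
      (fun r _ hrn T => Or.inr (stepLabel_le_of_name_le hi₁ hrn _ _))
      (fun r hr hrn T => Or.inr (hrn.elim
        (fun h => lt_of_mem r (name_mem_of_le hpre h.le hi₂) T)
        fun h => stepLabel_lt_of_name_lt hr hi₁ h _ _))
    exact ⟨e, s, t, pt, ps, ct, cs⟩
  · obtain ⟨t, pt, ct⟩ := h₁.exists_closes (a := stepLabel CT P Ri r₁ S)
      (b := stepLabel CT P Ri r₂ S) (fun T' => below hi₁)
      (fun r _ hrn T => Or.inr (stepLabel_le_of_name_le hi₂ hrn _ _))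
      (fun r hr hrn T => hrn.imp (fun h => stepLabel_lt_of_name_lt hr hi₁ h _ _)
        fun h => stepLabel_lt_of_name_lt hr hi₂ h _ _)
    obtain ⟨s, ps, cs⟩ := h₂.exists_closes (a := stepLabel CT P Ri r₂ S)
      (b := stepLabel CT P Ri r₁ S) (fun T' => below hi₂)
      (fun r _ hrn T => Or.inr (stepLabel_le_of_name_le hi₁ hrn _ _))
      (fun r hr hrn T => hrn.imp (fun h => stepLabel_lt_of_name_lt hr hi₂ h _ _)
        fun h => stepLabel_lt_of_name_lt hr hi₁ h _ _)
    exact ⟨e, s, t, pt, ps, ct, cs⟩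

/-- The side of a commuting square. -/
theorem exists_closes_of_step {r₁ r₂ : Rule C Pred R} {S₁ : State CT C Pred}
    (hr₁ : r₁ ∈ P.rules) (hr₂ : r₂ ∈ P.rules) (hS : S ≠ failedState CT C Pred)
    (h₁ : Step CT {r₁} S S₁) (h : Step CT {r₂} S₁ T) :
    ∃ t, Path (rankStep CT P Ri) t S₁ T ∧
      Closes [stepLabel CT P Ri r₁ S] [stepLabel CT P Ri r₂ S] t := by
  obtain ⟨t, ht, hl, p⟩ := exists_path_of_step (Ri := Ri) hr₂ h
  refine ⟨t, p, ?_⟩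
  -- The label of a coinductive rule does not depend on the state. That of an inductive rule does,
  -- but at `S₁` it is below the label of `r₁`: by decrease of rank if `r₁` is inductive, and by the
  -- first component otherwise.
  have : stepLabel CT P Ri r₂ S₁ < stepLabel CT P Ri r₁ S ∨
      stepLabel CT P Ri r₂ S₁ ≤ stepLabel CT P Ri r₂ S := by
    by_cases h₂ : r₂.name ∈ Ri
    · left
      by_cases h₁ : r₁.name ∈ Ri
      · exact stepLabel_lt_of_step hr₁ h₁ h₂ hS ‹_›
      · rw [stepLabel_coinductive h₁]; exact stepLabel_lt_of_inductive h₂ _ _ _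
    · right
      rw [stepLabel_coinductive h₂, stepLabel_coinductive h₂]
  rcases this with h' | h'
  · simpa using closes_of_shape (s₁ := t) (s₂ := []) (s₃ := [])
      (b := stepLabel CT P Ri r₂ S) (fun l hl => (ht l hl).trans_lt h') (by simp) (by simp)
      (by simp)
  · simpa using closes_of_shape (s₁ := []) (s₂ := t) (s₃ := [])
      (a := stepLabel CT P Ri r₁ S) (by simp) (fun l hl => (ht l hl).trans_le h') hl (by simp)

/-- Commuting peaks close directly, and peaks with a coinductive rule inherit the diagram of a
critical peak, after exchanging the sides if necessary. For two inductive rules joinability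
suffices, as in Newman's lemma: all labels on the joining paths are smaller than the rank of the
source. -/
theorem RuleDecreasingWrt.locallyDecreasing (hpre : Admissible Ri pre)
    (h : RuleDecreasingWrt CT P Ri pre) : LocallyDecreasing (rankStep CT P Ri) := by
  have key : ∀ {r₁ r₂ : Rule C Pred R} {S S₁ S₂ : State CT C Pred}, r₁ ∈ P.rules →
      r₂ ∈ P.rules → r₁.name ∉ Ri → S ≠ failedState CT C Pred → Step CT {r₁} S S₁ →
      Step CT {r₂} S S₂ → (¬ ∃ T, Step CT {r₂} S₁ T ∧ Step CT {r₁} S₂ T) →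
      ∃ e s t, Path (rankStep CT P Ri) t S₁ e ∧ Path (rankStep CT P Ri) s S₂ e ∧
        Closes [stepLabel CT P Ri r₁ S] [stepLabel CT P Ri r₂ S] t ∧
        Closes [stepLabel CT P Ri r₂ S] [stepLabel CT P Ri r₁ S] s := by
    intro r₁ r₂ S S₁ S₂ hr₁ hr₂ hi hS h₁ h₂ hn
    obtain ⟨f, hf, Sl, Sc, Sr, hc, rfl, rfl⟩ := (peak_cases (P := P.coinductivePart Ri)
      (Q := P.rules) ⟨hr₁, hi⟩ hr₂ h₁ h₂ hS).resolve_left hn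
    obtain ⟨e, k₁, k₂⟩ := h.coinductive_decreasing _ _ _ _ _ hc
    exact exists_closes_of_coinductive_peak hpre hr₂ hi hS h₂ ⟨f e, k₁.map CT hf, k₂.map CT hf⟩
  rintro _ _ S S₁ S₂ ⟨hS, r₁, hr₁, h₁, rfl⟩ ⟨-, r₂, hr₂, h₂, rfl⟩
  by_cases hcomm : ∃ T, Step CT {r₂} S₁ T ∧ Step CT {r₁} S₂ T
  · obtain ⟨T, k₁, k₂⟩ := hcomm
    obtain ⟨t, pt, ct⟩ := exists_closes_of_step (Ri := Ri) hr₁ hr₂ hS h₁ k₁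
    obtain ⟨s, ps, cs⟩ := exists_closes_of_step (Ri := Ri) hr₂ hr₁ hS h₂ k₂
    exact ⟨T, s, t, pt, ps, ct, cs⟩
  by_cases hi₁ : r₁.name ∈ Ri
  swap
  · exact key hr₁ hr₂ hi₁ hS h₁ h₂ hcomm
  by_cases hi₂ : r₂.name ∈ Ri
  swap
  · obtain ⟨e, s, t, pt, ps, ct, cs⟩ := key hr₂ hr₁ hi₂ hS h₂ h₁
      fun ⟨T, k₁, k₂⟩ => hcomm ⟨T, k₂, k₁⟩
    exact ⟨e, t, s, ps, pt, cs, ct⟩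
  obtain ⟨f, hf, Sl, Sc, Sr, hc, rfl, rfl⟩ := (peak_cases (P := P.inductivePart Ri)
    (Q := P.inductivePart Ri) ⟨hr₁, hi₁⟩ ⟨hr₂, hi₂⟩ h₁ h₂ hS).resolve_left hcomm
  obtain ⟨e, k₁, k₂⟩ := h.inductive_joinable _ _ _ _ _ hc
  obtain ⟨t, ht, pt⟩ := exists_path_of_inductive (k₁.lift f (hf _))
    fun r hr => stepLabel_lt_of_step hr₁ hi₁ hr hS h₁
  obtain ⟨s, hs, ps⟩ := exists_path_of_inductive (k₂.lift f (hf _))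
    fun r hr => stepLabel_lt_of_step hr₂ hi₂ hr hS h₂
  refine ⟨f e, s, t, pt, ps, ?_, ?_⟩
  · simpa using closes_of_shape (s₁ := t) (s₂ := []) (s₃ := []) ht (by simp) (by simp) (by simp)
  · simpa using closes_of_shape (s₁ := s) (s₂ := []) (s₃ := []) hs (by simp) (by simp) (by simp)

/-- The omitted transitions start at the failed state and are loops. -/
theorem reflTransGen_rankStep : Relation.ReflTransGen (fun S T => ∃ l, rankStep CT P Ri l S T) =
    Relation.ReflTransGen (Step CT P.rules) := by
  ext S T
  constructor
  · exact Relation.ReflTransGen.mono (fun S T ⟨_, _, r, hr, h, _⟩ => singleton_step_mono hr h) _ _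
  · intro h
    induction h with
    | refl => exact .refl
    | tail _ h ih =>
      obtain ⟨r, hr, h⟩ := exists_singleton_step h
      obtain ⟨s, -, -, p⟩ := exists_path_of_step (Ri := Ri) hr h
      exact ih.trans p.reflTransGen

end Confluence

end CHR

theorem mainTheorem1 {L : FirstOrder.Language.{u, v}} (CT : L.Theory)
    {C : CHR.ConstraintLanguage L} {Pred : ℕ → Type w} {R : Type z}
    (Ri : Set R) (P : CHR.Program C Pred R) (hP : CHR.RuleDecreasing CT P Ri) :
    P.Confluent CT := by
  obtain ⟨pre, hpre, h⟩ := hP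
  have hwf := h.terminating.isWellFounded
  have hc := (h.locallyDecreasing hpre).confluent
  unfold CHR.Confluent at hc
  rw [CHR.reflTransGen_rankStep] at hc
  exact hc
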